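/- Theorem 4.2. Let $d\in\mathbb N$, $d\ge 1$, let $\gamma$ be the standard Gaussian measure on $\mathbb R^d$, and let $L_2(\mathbb R^d,\gamma)$ be the space of square-integrable functions (real-valued or complex-valued). For $k\in\mathbb N_0$ let $H_k(x)=\frac{(-1)^k}{\sqrt{k!}}\,e^{x^2/2}\frac{d^k}{dx^k}e^{-x^2/2}$, for $\mathbf k\in\mathbb N_0^d$ put $H_{\mathbf k}(\mathbf x)=\prod_{j=1}^d H_{k_j}(x_j)$, and for $f\in L_2(\mathbb R^d,\gamma)$ put $\hat f(\mathbf k)=\int_{\mathbb R^d} f H_{\mathbf k}\,d\gamma$. For real $\alpha>0$ let $\mathcal H^\alpha$ be the space of all $f\in L_2(\mathbb R^d,\gamma)$ that are represented by their Hermite series $f=\sum_{\mathbf k}\hat f(\mathbf k)H_{\mathbf k}$ (convergence in $L_2(\mathbb R^d,\gamma)$; this holds for every $f\in L_2(\mathbb R^d,\gamma)$) and for which $$\|f\|_{\mathcal H^\alpha}=\Big(\sum_{\mathbf k\in\mathbb N_0^d}\ \prod_{j=1}^d(k_j+1)^\alpha\,|\hat f(\mathbf k)|^2\Big)^{1/2}$$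 is finite, normed by $\|\cdot\|_{\mathcal H^\alpha}$, and let $I_\gamma:\mathcal H^\alpha\to L_2(\mathbb R^d,\gamma)$, $I_\gamma f=f$, be the embedding. For a bounded linear operator $T:X\to Y$ between normed spaces and $n\ge1$ let - $a_n(T)=\inf\{\|T-A\| : A:X\to Y \text{ bounded linear},\ \operatorname{rank}A<n\}$ (approximation numbers), - $b_n(T)=\sup_{L}\ \inf_{x\in L,\,x\ne0}\|Tx\|/\|x\|$, over all subspaces $L\subseteq X$ with $\dim L=n$ (Bernstein numbers), - $c_n(T)=\inf\{\|T|_M\| : M\subseteq X \text{ a subspace},\ \operatorname{codim}M<n\}$ (Gelfand numbers), - $d_n(T)=\inf_{L}\ \sup_{\|x\|\le1}\ \inf_{y\in L}\|Tx-y\|$, over all subspaces $L\subseteq Y$ with $\dim L=n-1$ (Kolmogorov numbers), - $e_n(T)=\inf\{\varepsilon>0 : T(\{\|x\|\le1\}) \text{ is covered by } 2^{n-1} \text{ balls of radius } \varepsilon \text{ in } Y\}$ (dyadic entropy numbers), - $x_n(T)=\sup\{a_n(TA) : A:\ell_2\to X \text{ bounded linear},\ \|A\|\le1\}$ (Weyl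 numbers). Then for every $\alpha>0$ and every $s\in\{a,b,c,d,e,x\}$ there are constants $0<c\le C<\infty$, independent of $n$, such that for all $n\ge2$ $$c\,n^{-\frac\alpha2}(\log n)^{\frac{(d-1)\alpha}2}\le s_n\big(I_\gamma:\mathcal H^\alpha\to L_2(\mathbb R^d,\gamma)\big)\le C\,n^{-\frac\alpha2}(\log n)^{\frac{(d-1)\alpha}2}.$$ Moreover, for every $s\in\{a,b,c,d,x\}$, $$\lim_{n\to\infty}\frac{s_n\big(I_\gamma:\mathcal H^\alpha\to L_2(\mathbb R^d,\gamma)\big)}{n^{-\frac\alpha2}(\ln n)^{\frac{\alpha(d-1)}2}}=\Big(\frac1{(d-1)!}\Big)^{\alpha/2}.$$ -/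

import Mathlib

open MeasureTheory ProbabilityTheory Filter Topology

noncomputable section

/-! ### Approximation quantities of a bounded linear operator

All of them are used for `n ≥ 1` only; all sets whose infimum or supremum is taken below are then
bounded (by `0` and `‖T‖`). -/

section SNumbers

variable {𝕜 : Type*} [RCLike 𝕜]
variable {X : Type*} [NormedAddCommGroup X] [NormedSpace 𝕜 X]
variable {Y : Type*} [NormedAddCommGroup Y] [NormedSpace 𝕜 Y]

/-- The `n`-th approximation number: the distance of `T` to the bounded operators of rank `< n`. -/
def approximationNumber (n : ℕ) (T : X →L[𝕜] Y) : ℝ :=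
  sInf {t : ℝ | ∃ A : X →L[𝕜] Y, (A : X →ₗ[𝕜] Y).rank < (n : Cardinal) ∧ t = ‖T - A‖}

/-- The `n`-th Kolmogorov number: the infimum over the `(n-1)`-dimensional subspaces `L` of `Y` of
`sup_{‖x‖ ≤ 1} inf_{y ∈ L} ‖T x - y‖`. -/
def kolmogorovNumber (n : ℕ) (T : X →L[𝕜] Y) : ℝ :=
  sInf {t : ℝ | ∃ L : Submodule 𝕜 Y, Module.rank 𝕜 L = ((n - 1 : ℕ) : Cardinal) ∧
    t = ⨆ x : {x : X // ‖x‖ ≤ 1}, ⨅ y : L, ‖T x - y‖}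

/-- The `n`-th Gelfand number: the infimum of the norms of the restrictions of `T` to the subspaces
of `X` of codimension `< n`. -/
def gelfandNumber (n : ℕ) (T : X →L[𝕜] Y) : ℝ :=
  sInf {t : ℝ | ∃ M : Submodule 𝕜 X, Module.rank 𝕜 (X ⧸ M) < (n : Cardinal) ∧
    t = ‖T.comp M.subtypeL‖}

/-- The `n`-th Weyl number: the supremum of the approximation numbers `a_n(T A)` over the operators
`A : ℓ₂ → X` with `‖A‖ ≤ 1`. -/
def weylNumber (n : ℕ) (T : X →L[𝕜] Y) : ℝ :=
  sSup {t : ℝ | ∃ A : lp (fun _ : ℕ => 𝕜) 2 →L[𝕜] X, ‖A‖ ≤ 1 ∧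
    t = approximationNumber n (T.comp A)}

/-- The `n`-th dyadic entropy number: the infimum of the `ε > 0` such that the image of the closed
unit ball is covered by `2 ^ (n - 1)` balls of radius `ε`. -/
def entropyNumber (n : ℕ) (T : X →L[𝕜] Y) : ℝ :=
  sInf {ε : ℝ | 0 < ε ∧ ∃ y : Fin (2 ^ (n - 1)) → Y,
    T '' Metric.closedBall (0 : X) 1 ⊆ ⋃ i, Metric.closedBall (y i) ε}

/-- The `n`-th Bernstein number: the supremum over the `n`-dimensional subspaces `L` of `X` of
`inf_{x ∈ L, x ≠ 0} ‖T x‖ / ‖x‖`. -/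
def bernsteinNumber (n : ℕ) (T : X →L[𝕜] Y) : ℝ :=
  sSup {t : ℝ | ∃ L : Submodule 𝕜 X, Module.rank 𝕜 L = (n : Cardinal) ∧
    t = ⨅ x : {x : X // x ∈ L ∧ x ≠ 0}, ‖T x‖ / ‖(x : X)‖}

/-- The labels of the six quantities: approximation, Bernstein, Gelfand, Kolmogorov, entropy and
Weyl numbers. -/
inductive SKind : Type
  | a
  | b
  | c
  | d
  | e
  | x

/-- The quantity `s_n(T)` for `s ∈ {a, b, c, d, e, x}`. -/
def sNumber (s : SKind) (n : ℕ) (T : X →L[𝕜] Y) : ℝ :=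
  match s with
  | SKind.a => approximationNumber n T
  | SKind.b => bernsteinNumber n T
  | SKind.c => gelfandNumber n T
  | SKind.d => kolmogorovNumber n T
  | SKind.e => entropyNumber n T
  | SKind.x => weylNumber n T

end SNumbers

/-! ### Hermite polynomials and Gaussian-weighted spaces -/

/-- The `d`-dimensional standard Gaussian measure. -/
abbrev gaussianMeasure (d : ℕ) : Measure (EuclideanSpace ℝ (Fin d)) :=
  stdGaussian (EuclideanSpace ℝ (Fin d))

/-- The space `L₂(ℝ^d, γ)` of `𝕜`-valued functions. -/
abbrev GaussianL2 (𝕜 : Type*) [RCLike 𝕜] (d : ℕ) : Type _ :=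
  Lp 𝕜 2 (gaussianMeasure d)

/-- The normalized probabilists' Hermite polynomial of degree `k`. -/
def hermiteOne (k : ℕ) (t : ℝ) : ℝ :=
  Polynomial.aeval t (Polynomial.hermite k) / √(k.factorial : ℝ)

/-- The `d`-variate normalized Hermite polynomial with multi-index `k`. -/
def hermiteMulti {d : ℕ} (k : Fin d → ℕ) (x : EuclideanSpace ℝ (Fin d)) : ℝ :=
  ∏ j, hermiteOne (k j) (x j)

/-- The Rodrigues formula for `hermiteOne`. -/
lemma hermiteOne_eq (k : ℕ) (t : ℝ) :
    hermiteOne k t = (-1) ^ k / √(k.factorial : ℝ) * Real.exp (t ^ 2 / 2) *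
      iteratedDeriv k (fun y => Real.exp (-(y ^ 2) / 2)) t := by
  have h : (fun y : ℝ => Real.exp (-(y ^ 2) / 2)) = fun y => Real.exp (-(y ^ 2 / 2)) := by
    funext y; rw [neg_div]
  rw [hermiteOne, Polynomial.hermite_eq_deriv_gaussian', h, iteratedDeriv_eq_iterate]
  ring

lemma integrable_hermiteOne_sq (k : ℕ) :
    Integrable (fun t => hermiteOne k t ^ 2) (gaussianReal 0 1) := by
  have key : ∀ p : Polynomial ℝ, Integrable (fun t => p.eval t) (gaussianReal 0 1) := by
    intro p
    simp_rw [Polynomial.eval_eq_sum_range]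
    refine integrable_finsetSum _ fun i _ => Integrable.const_mul ?_ _
    rcases Nat.eq_zero_or_pos i with rfl | hi
    · simp
    · have h := (memLp_id_gaussianReal (μ := 0) (v := 1) (i : NNReal)).integrable_norm_rpow
        (by simpa using hi.ne') (by simp)
      refine (integrable_norm_iff (by fun_prop)).1 ?_
      simpa [norm_pow] using h
  have h := key (((Polynomial.hermite k).map (algebraMap ℤ ℝ)) ^ 2)
  convert h.div_const (k.factorial : ℝ) using 2 with t
  rw [hermiteOne, div_pow, Real.sq_sqrt (by positivity), Polynomial.eval_pow,
    Polynomial.eval_map_algebraMap]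

lemma continuous_hermiteMulti {d : ℕ} (k : Fin d → ℕ) : Continuous (hermiteMulti k) := by
  unfold hermiteMulti hermiteOne
  refine continuous_finsetProd _ fun j _ => Continuous.div_const ?_ _
  exact (Polynomial.continuous_aeval _).comp (by fun_prop)

lemma memLp_hermiteMulti {d : ℕ} (k : Fin d → ℕ) :
    MemLp (hermiteMulti k) 2 (gaussianMeasure d) := by
  rw [memLp_two_iff_integrable_sq (continuous_hermiteMulti k).aestronglyMeasurable,
    gaussianMeasure, ← map_pi_eq_stdGaussian,
    integrable_map_measure (f := WithLp.toLp 2) (g := fun x => hermiteMulti k x ^ 2)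
      ((continuous_hermiteMulti k).pow 2).aestronglyMeasurable (by fun_prop)]
  have h := Integrable.fintype_prod (μ := fun _ : Fin d => gaussianReal 0 1)
    (f := fun j t => hermiteOne (k j) t ^ 2) fun j => integrable_hermiteOne_sq (k j)
  convert h using 2 with x
  simp [hermiteMulti, Finset.prod_pow]

section HermiteSpace

variable (𝕜 : Type*) [RCLike 𝕜]

lemma memLp_ofReal_hermiteMulti {d : ℕ} (k : Fin d → ℕ) :
    MemLp (fun x => ((hermiteMulti k x : ℝ) : 𝕜)) 2 (gaussianMeasure d) :=
  (memLp_hermiteMulti k).ofReal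

/-- The Hermite polynomial with multi-index `k` as an element of `L₂(ℝ^d, γ)`. -/
def hermiteL2 {d : ℕ} (k : Fin d → ℕ) : GaussianL2 𝕜 d :=
  (memLp_ofReal_hermiteMulti 𝕜 k).toLp _

variable {𝕜}

/-- The Hermite coefficient `∫ f H_k dγ` of `f`. -/
def hermiteCoeff {d : ℕ} (f : GaussianL2 𝕜 d) (k : Fin d → ℕ) : 𝕜 :=
  ∫ x, f x * ((hermiteMulti k x : ℝ) : 𝕜) ∂(gaussianMeasure d)

lemma hermiteCoeff_eq_inner {d : ℕ} (f : GaussianL2 𝕜 d) (k : Fin d → ℕ) :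
    hermiteCoeff f k = inner 𝕜 (hermiteL2 𝕜 k) f := by
  rw [L2.inner_def]
  refine integral_congr_ae ?_
  filter_upwards [(memLp_ofReal_hermiteMulti 𝕜 k).coeFn_toLp] with x hx
  rw [hermiteL2, hx, RCLike.inner_apply, RCLike.conj_ofReal]

/-- The weight `∏_j (k_j + 1)^α`. -/
def hermiteWeight {d : ℕ} (α : ℝ) (k : Fin d → ℕ) : ℝ :=
  ∏ j, ((k j : ℝ) + 1) ^ α

lemma hermiteWeight_pos {d : ℕ} (α : ℝ) (k : Fin d → ℕ) : 0 < hermiteWeight α k :=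
  Finset.prod_pos fun j _ => by positivity

lemma one_le_hermiteWeight {d : ℕ} {α : ℝ} (hα : 0 ≤ α) (k : Fin d → ℕ) :
    1 ≤ hermiteWeight α k := by
  unfold hermiteWeight
  exact Finset.one_le_prod fun j _ => Real.one_le_rpow (by simp) hα

lemma memℓp_hermite_iff {d : ℕ} (α : ℝ) (f : GaussianL2 𝕜 d) :
    Memℓp (fun k => ((√(hermiteWeight α k) : ℝ) : 𝕜) * hermiteCoeff f k) 2 ↔
      Summable fun k => hermiteWeight α k * ‖hermiteCoeff f k‖ ^ 2 := by
  rw [memℓp_gen_iff (by simp)]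
  refine summable_congr fun k => ?_
  rw [norm_mul, RCLike.norm_ofReal, abs_of_nonneg (Real.sqrt_nonneg _)]
  simp [mul_pow, Real.sq_sqrt (hermiteWeight_pos α k).le]

variable (𝕜)

/-- The functions of `L₂(ℝ^d, γ)` that are represented by their Hermite series, convergent in
`L₂(ℝ^d, γ)`, and for which `∑_k ∏_j (k_j + 1)^α |f̂(k)|²` is finite. (The first condition holds
for every function of `L₂(ℝ^d, γ)`, as the Hermite polynomials are an orthonormal basis.) -/
def hermiteSubmodule (d : ℕ) (α : ℝ) : Submodule 𝕜 (GaussianL2 𝕜 d) where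
  carrier := {f | HasSum (fun k : Fin d → ℕ => hermiteCoeff f k • hermiteL2 𝕜 k) f ∧
    Summable fun k : Fin d → ℕ => hermiteWeight α k * ‖hermiteCoeff f k‖ ^ 2}
  zero_mem' := by simp [hermiteCoeff_eq_inner]
  add_mem' := by
    rintro f g ⟨hf, hf'⟩ ⟨hg, hg'⟩
    refine ⟨?_, ?_⟩
    · simpa [hermiteCoeff_eq_inner, inner_add_right, add_smul] using hf.add hg
    · rw [← memℓp_hermite_iff] at hf' hg' ⊢
      convert hf'.add hg' using 1
      funext k
      simp [hermiteCoeff_eq_inner, inner_add_right, mul_add]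
  smul_mem' := by
    rintro c f ⟨hf, hf'⟩
    refine ⟨?_, ?_⟩
    · simpa [hermiteCoeff_eq_inner, inner_smul_right, mul_smul] using hf.const_smul c
    · refine (hf'.mul_left (‖c‖ ^ 2)).congr fun k => ?_
      simp [hermiteCoeff_eq_inner, inner_smul_right, mul_pow]
      ring

/-- The space `ℋ^α`; its norm is defined below and is not the norm of `L₂(ℝ^d, γ)`. -/
def HermiteSpace (d : ℕ) (α : ℝ) : Type _ := hermiteSubmodule 𝕜 d α

variable {𝕜} {d : ℕ} {α : ℝ}

namespace HermiteSpace

instance : AddCommGroup (HermiteSpace 𝕜 d α) :=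
  inferInstanceAs (AddCommGroup (hermiteSubmodule 𝕜 d α))

instance : Module 𝕜 (HermiteSpace 𝕜 d α) :=
  inferInstanceAs (Module 𝕜 (hermiteSubmodule 𝕜 d α))

/-- The inclusion of `ℋ^α` into `L₂(ℝ^d, γ)` as a linear map. -/
def toL2 : HermiteSpace 𝕜 d α →ₗ[𝕜] GaussianL2 𝕜 d :=
  (hermiteSubmodule 𝕜 d α).subtype

lemma hasSum (f : HermiteSpace 𝕜 d α) :
    HasSum (fun k : Fin d → ℕ => hermiteCoeff (toL2 f) k • hermiteL2 𝕜 k) (toL2 f) :=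
  f.2.1

lemma summable (f : HermiteSpace 𝕜 d α) :
    Summable fun k : Fin d → ℕ => hermiteWeight α k * ‖hermiteCoeff (toL2 f) k‖ ^ 2 :=
  f.2.2

/-- The norm `‖f‖ = (∑_k ∏_j (k_j + 1)^α |f̂(k)|²)^{1/2}` of `ℋ^α`. -/
instance : Norm (HermiteSpace 𝕜 d α) where
  norm f := √(∑' k : Fin d → ℕ, hermiteWeight α k * ‖hermiteCoeff (toL2 f) k‖ ^ 2)

lemma norm_def (f : HermiteSpace 𝕜 d α) :
    ‖f‖ = √(∑' k : Fin d → ℕ, hermiteWeight α k * ‖hermiteCoeff (toL2 f) k‖ ^ 2) :=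
  rfl

lemma norm_sq (f : HermiteSpace 𝕜 d α) :
    ‖f‖ ^ 2 = ∑' k : Fin d → ℕ, hermiteWeight α k * ‖hermiteCoeff (toL2 f) k‖ ^ 2 :=
  Real.sq_sqrt (tsum_nonneg fun k => mul_nonneg (hermiteWeight_pos α k).le (by positivity))

/-- The weighted coefficient sequence of an element of `ℋ^α`. -/
def toSeq (f : HermiteSpace 𝕜 d α) : lp (fun _ : Fin d → ℕ => 𝕜) 2 :=
  ⟨fun k => ((√(hermiteWeight α k) : ℝ) : 𝕜) * hermiteCoeff (toL2 f) k,
    (memℓp_hermite_iff α _).2 f.summable⟩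

lemma norm_toSeq (f : HermiteSpace 𝕜 d α) : ‖toSeq f‖ = ‖f‖ := by
  rw [norm_def, lp.norm_eq_tsum_rpow (by simp), Real.sqrt_eq_rpow]
  congr 1
  refine tsum_congr fun k => ?_
  simp [toSeq, mul_pow, Real.sq_sqrt (hermiteWeight_pos α k).le]

lemma toSeq_add (f g : HermiteSpace 𝕜 d α) : toSeq (f + g) = toSeq f + toSeq g := by
  ext k
  simp [toSeq, hermiteCoeff_eq_inner, inner_add_right, mul_add]
  rfl

lemma toSeq_smul (c : 𝕜) (f : HermiteSpace 𝕜 d α) : toSeq (c • f) = c • toSeq f := by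
  ext k
  simp [toSeq, hermiteCoeff_eq_inner, inner_smul_right]
  ring

lemma core : NormedSpace.Core 𝕜 (HermiteSpace 𝕜 d α) where
  norm_nonneg f := Real.sqrt_nonneg _
  norm_smul c f := by rw [← norm_toSeq, toSeq_smul, norm_smul, norm_toSeq]
  norm_triangle f g := by
    rw [← norm_toSeq, toSeq_add, ← norm_toSeq f, ← norm_toSeq g]
    exact norm_add_le _ _
  norm_eq_zero_iff f := by
    refine ⟨fun h => ?_, fun h => by subst h; simp [norm_def, hermiteCoeff_eq_inner]⟩
    rw [← norm_toSeq, norm_eq_zero] at h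
    have hc : ∀ k : Fin d → ℕ, hermiteCoeff (toL2 f) k = 0 := by
      intro k
      have hk : ((√(hermiteWeight α k) : ℝ) : 𝕜) * hermiteCoeff (toL2 f) k = 0 :=
        congrArg (fun u : lp (fun _ : Fin d → ℕ => 𝕜) 2 => u k) h
      refine (mul_eq_zero.1 hk).resolve_left ?_
      exact RCLike.ofReal_ne_zero.2 (Real.sqrt_pos.2 (hermiteWeight_pos α k)).ne'
    have h0 := f.hasSum
    simp only [hc, zero_smul] at h0
    exact Subtype.ext (h0.unique hasSum_zero)

instance : NormedAddCommGroup (HermiteSpace 𝕜 d α) := NormedAddCommGroup.ofCore core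

instance : NormedSpace 𝕜 (HermiteSpace 𝕜 d α) := NormedSpace.ofCore core

lemma norm_toL2_le (hα : 0 ≤ α) (f : HermiteSpace 𝕜 d α) : ‖toL2 f‖ ≤ ‖f‖ := by
  refine le_of_sq_le_sq ?_ (norm_nonneg _)
  have h1 := (f.hasSum.mapL (innerSL 𝕜 (toL2 f)))
  have h2 : HasSum (fun k : Fin d → ℕ => ‖hermiteCoeff (toL2 f) k‖ ^ 2) (‖toL2 f‖ ^ 2) := by
    have h3 := RCLike.hasSum_re 𝕜 h1
    convert h3 using 1
    · funext k
      rw [innerSL_apply_apply, inner_smul_right, ← inner_conj_symm, ← hermiteCoeff_eq_inner,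
        RCLike.mul_conj]
      norm_cast
    · rw [innerSL_apply_apply, inner_self_eq_norm_sq]
  rw [norm_sq]
  refine hasSum_le (fun k => ?_) h2 f.summable.hasSum
  exact le_mul_of_one_le_left (by positivity) (one_le_hermiteWeight hα k)

end HermiteSpace

/-- The embedding `I_γ : ℋ^α → L₂(ℝ^d, γ)`, `f ↦ f`. -/
def hermiteEmbedding (𝕜 : Type*) [RCLike 𝕜] (d : ℕ) (α : ℝ) (hα : 0 ≤ α) :
    HermiteSpace 𝕜 d α →L[𝕜] GaussianL2 𝕜 d :=
  HermiteSpace.toL2.mkContinuous 1 fun f => by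
    simpa using HermiteSpace.norm_toL2_le hα f

end HermiteSpace

end

/-! ### Counting lattice points in hyperbolic crosses -/

/-! In the coordinates given by the orthonormal Hermite polynomials, the embedding is a diagonal
operator with singular values `crossProd k ^ (-(α / 2))`. Completeness of the Hermite system is not
needed, because every element of `HermiteSpace` is by definition the sum of its Hermite series.

For such an operator the approximation, Bernstein, Gelfand, Kolmogorov and Weyl numbers all equal
the `n`-th largest singular value. Keeping the `n - 1` largest coordinates gives the upper bounds
(`IsCompressibleTo`). On the span of the `n` largest ones the operator is bounded below
(`IsBoundedBelowBy`), and by rank-nullity that span contains a nonzero vector annihilated by any map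
of rank below `n`; this gives the lower bounds. They are combined in `sNumber_eq`. With `e = d - 1`,
the `n`-th singular value is `m ^ (-(α / 2))` for `m = crossValue e n`.

What remains is lattice point counting: a hyperbolic cross in dimension `e + 1` has about `x * (log
x) ^ e / e!` points (`tendsto_card_hyperbolicCross`). Inverting this gives `m ~ e! * n / (log n) ^
e`, hence the limit, and the two-sided bounds follow from the limit.

Entropy numbers are compared with singular values through volumes. From below, `2 ^ (n - 1)` balls
cannot cover an `n`-dimensional ball of radius `m ^ (-(α / 2))` if their radius is less than half of
it. From above, the series is truncated to a cross with `x` of order `n / (log n) ^ e` and the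
resulting ellipsoid is covered by a volume count. No logarithm is lost because the sum of `log (x /
crossProd k)` over the cross is at most `x * crossSum e x` (`sum_log_div_crossProd_le`). -/

/-- The product `∏_j (k_j + 1)`. -/
noncomputable def crossProd {d : ℕ} (k : Fin d → ℕ) : ℝ := ∏ j, ((k j : ℝ) + 1)

lemma one_le_crossProd {d : ℕ} (k : Fin d → ℕ) : 1 ≤ crossProd k :=
  Finset.one_le_prod fun j _ => by simp

lemma crossProd_pos {d : ℕ} (k : Fin d → ℕ) : 0 < crossProd k :=
  one_pos.trans_le (one_le_crossProd k)

lemma crossProd_cons {d : ℕ} (j : ℕ) (k : Fin d → ℕ) :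
    crossProd (Fin.cons j k : Fin (d + 1) → ℕ) = ((j : ℝ) + 1) * crossProd k := by
  simp [crossProd, Fin.prod_univ_succ]

lemma le_crossProd {d : ℕ} (k : Fin d → ℕ) (j : Fin d) : (k j : ℝ) + 1 ≤ crossProd k := by
  have h : ∏ i ∈ {j}, ((k i : ℝ) + 1) ≤ ∏ i, ((k i : ℝ) + 1) :=
    Finset.prod_le_prod_of_subset_of_one_le (Finset.subset_univ _)
      (fun i _ => by positivity) (fun i _ _ => by simp)
  simpa [crossProd] using h

/-- The hyperbolic cross `{k | ∏_j (k_j + 1) ≤ x}`. -/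
noncomputable def hyperbolicCross (d : ℕ) (x : ℝ) : Finset (Fin d → ℕ) :=
  open Classical in
  (Fintype.piFinset fun _ => Finset.range ⌊x⌋₊).filter fun k => crossProd k ≤ x

lemma mem_hyperbolicCross {d : ℕ} {x : ℝ} {k : Fin d → ℕ} :
    k ∈ hyperbolicCross d x ↔ crossProd k ≤ x := by
  simp only [hyperbolicCross, Finset.mem_filter, Fintype.mem_piFinset, Finset.mem_range,
    and_iff_right_iff_imp]
  intro h j
  rw [← Nat.succ_le_iff, Nat.le_floor_iff' (by simp)]
  push_cast
  exact (le_crossProd k j).trans h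

lemma hyperbolicCross_eq_empty {d : ℕ} {x : ℝ} (hx : x < 1) : hyperbolicCross d x = ∅ := by
  ext k
  simpa [mem_hyperbolicCross] using hx.trans_le (one_le_crossProd k)

lemma hyperbolicCross_zero {x : ℝ} (hx : 1 ≤ x) : hyperbolicCross 0 x = {Fin.elim0} := by
  ext k
  simp only [mem_hyperbolicCross, Finset.mem_singleton, eq_iff_true_of_subsingleton, iff_true]
  simpa [crossProd] using hx

lemma hyperbolicCross_mono {d : ℕ} {x y : ℝ} (h : x ≤ y) :
    hyperbolicCross d x ⊆ hyperbolicCross d y := fun _ hk =>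
  mem_hyperbolicCross.2 ((mem_hyperbolicCross.1 hk).trans h)

lemma lt_floor_iff {x : ℝ} {j : ℕ} : j < ⌊x⌋₊ ↔ (j : ℝ) + 1 ≤ x := by
  rw [← Nat.succ_le_iff, Nat.le_floor_iff' (by simp)]
  push_cast
  rfl

/-- Slicing by the first coordinate, which drives the induction on the dimension for `crossSum`. -/
lemma sum_hyperbolicCross_succ {d : ℕ} (x : ℝ) (f : (Fin (d + 1) → ℕ) → ℝ) :
    ∑ k ∈ hyperbolicCross (d + 1) x, f k =
      ∑ j ∈ Finset.range ⌊x⌋₊, ∑ k ∈ hyperbolicCross d (x / ((j : ℝ) + 1)),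
        f (Fin.cons j k) := by
  rw [Finset.sum_sigma']
  refine Finset.sum_bij' (fun k _ => ⟨k 0, Fin.tail k⟩) (fun p _ => Fin.cons p.1 p.2)
    ?_ ?_ ?_ ?_ ?_
  · intro k hk
    rw [← Fin.cons_self_tail k, mem_hyperbolicCross, crossProd_cons] at hk
    simp only [Finset.mem_sigma, Finset.mem_range, lt_floor_iff, mem_hyperbolicCross]
    refine ⟨le_trans ?_ hk, ?_⟩
    · exact le_mul_of_one_le_right (by positivity) (one_le_crossProd _)
    · rw [le_div_iff₀ (by positivity)]
      linarith
  · rintro ⟨j, k⟩ h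
    simp only [Finset.mem_sigma, Finset.mem_range, mem_hyperbolicCross] at h
    have h2 := h.2
    rw [le_div_iff₀ (by positivity)] at h2
    rw [mem_hyperbolicCross, crossProd_cons]
    linarith
  · intro k _
    simp
  · rintro ⟨j, k⟩ _
    simp
  · intro k _
    simp

/-- The opposite order of summation: the first coordinate runs innermost, so counting it produces a
single floor. -/
lemma sum_hyperbolicCross_succ' {d : ℕ} (x : ℝ) (f : (Fin (d + 1) → ℕ) → ℝ) :
    ∑ k ∈ hyperbolicCross (d + 1) x, f k =
      ∑ k ∈ hyperbolicCross d x, ∑ j ∈ Finset.range ⌊x / crossProd k⌋₊, f (Fin.cons j k) := by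
  rw [Finset.sum_sigma']
  refine Finset.sum_bij' (fun k _ => ⟨Fin.tail k, k 0⟩) (fun p _ => Fin.cons p.2 p.1)
    ?_ ?_ ?_ ?_ ?_
  · intro k hk
    rw [← Fin.cons_self_tail k, mem_hyperbolicCross, crossProd_cons] at hk
    simp only [Finset.mem_sigma, Finset.mem_range, lt_floor_iff, mem_hyperbolicCross]
    refine ⟨le_trans ?_ hk, ?_⟩
    · exact le_mul_of_one_le_left (crossProd_pos _).le (by simp)
    · rwa [le_div_iff₀ (crossProd_pos _)]
  · rintro ⟨k, j⟩ h
    simp only [Finset.mem_sigma, Finset.mem_range, lt_floor_iff, mem_hyperbolicCross] at h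
    have h2 := h.2
    rw [le_div_iff₀ (crossProd_pos _)] at h2
    rwa [mem_hyperbolicCross, crossProd_cons]
  · intro k _
    simp
  · rintro ⟨k, j⟩ _
    simp
  · intro k _
    simp

/-! ### Harmonic sums over hyperbolic crosses -/

/-- The sum of the reciprocals of `∏_j (k_j + 1)` over a hyperbolic cross. -/
noncomputable def crossSum (d : ℕ) (x : ℝ) : ℝ := ∑ k ∈ hyperbolicCross d x, (crossProd k)⁻¹

lemma crossSum_nonneg (d : ℕ) (x : ℝ) : 0 ≤ crossSum d x :=
  Finset.sum_nonneg fun k _ => (inv_pos.2 (crossProd_pos k)).le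

lemma crossSum_zero {x : ℝ} (hx : 1 ≤ x) : crossSum 0 x = 1 := by
  simp [crossSum, hyperbolicCross_zero hx, crossProd]

lemma crossSum_succ (d : ℕ) (x : ℝ) :
    crossSum (d + 1) x =
      ∑ j ∈ Finset.range ⌊x⌋₊, ((j : ℝ) + 1)⁻¹ * crossSum d (x / ((j : ℝ) + 1)) := by
  rw [crossSum, sum_hyperbolicCross_succ]
  refine Finset.sum_congr rfl fun j _ => ?_
  rw [crossSum, Finset.mul_sum]
  exact Finset.sum_congr rfl fun k _ => by rw [crossProd_cons, mul_inv]

/-- A discrete form of the derivative of a power, from the factorization of `a ^ (d + 1) - b ^ (d +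
1)`. With its companion below it turns sums of powers of logarithms into telescoping sums. -/
lemma pow_succ_sub_pow_succ_le {a b : ℝ} (d : ℕ) (hb : 0 ≤ b) (hab : b ≤ a) :
    a ^ (d + 1) - b ^ (d + 1) ≤ (d + 1) * ((a - b) * a ^ d) := by
  have h := Commute.mul_geom_sum₂ (Commute.all a b) (d + 1)
  rw [← h]
  have : ∑ i ∈ Finset.range (d + 1), a ^ i * b ^ (d + 1 - 1 - i) ≤ (d + 1) * a ^ d := by
    have : ∀ i ∈ Finset.range (d + 1), a ^ i * b ^ (d + 1 - 1 - i) ≤ a ^ d := by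
      intro i hi
      have hi' : i ≤ d := Nat.lt_succ_iff.1 (Finset.mem_range.1 hi)
      calc a ^ i * b ^ (d + 1 - 1 - i) ≤ a ^ i * a ^ (d - i) := by
            simp only [Nat.add_sub_cancel]
            gcongr
            exact pow_nonneg (hb.trans hab) _
        _ = a ^ d := by rw [← pow_add, Nat.add_sub_cancel' hi']
    simpa using Finset.sum_le_card_nsmul _ _ _ this
  nlinarith [sub_nonneg.2 hab]

lemma le_pow_succ_sub_pow_succ {a b : ℝ} (d : ℕ) (hb : 0 ≤ b) (hab : b ≤ a) :
    (d + 1) * ((a - b) * b ^ d) ≤ a ^ (d + 1) - b ^ (d + 1) := by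
  have h := Commute.mul_geom_sum₂ (Commute.all a b) (d + 1)
  rw [← h]
  have : (d + 1) * b ^ d ≤ ∑ i ∈ Finset.range (d + 1), a ^ i * b ^ (d + 1 - 1 - i) := by
    have : ∀ i ∈ Finset.range (d + 1), b ^ d ≤ a ^ i * b ^ (d + 1 - 1 - i) := by
      intro i hi
      have hi' : i ≤ d := Nat.lt_succ_iff.1 (Finset.mem_range.1 hi)
      calc b ^ d = b ^ i * b ^ (d - i) := by rw [← pow_add, Nat.add_sub_cancel' hi']
        _ ≤ a ^ i * b ^ (d + 1 - 1 - i) := by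
            simp only [Nat.add_sub_cancel]
            gcongr
    simpa using Finset.card_nsmul_le_sum _ _ _ this
  nlinarith [sub_nonneg.2 hab]

/-- By induction each slice is at least `(log (x / (j + 1))) ^ d / (d! * (j + 1))`. Since the
logarithm drops by at most `1 / (j + 1)` from `j` to `j + 1`, this dominates a telescoping
difference of powers of order `d + 1`. -/
lemma log_pow_div_factorial_le_crossSum (d : ℕ) :
    ∀ {x : ℝ}, 1 ≤ x → Real.log x ^ d / d.factorial ≤ crossSum d x := by
  induction d with
  | zero => intro x hx; simp [crossSum_zero hx]
  | succ d ih =>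
    intro x hx
    have hx0 : 0 < x := by linarith
    -- Cutting off at `0` makes the telescoping sum end in exactly `0` at `j = ⌊x⌋₊`, where the
    -- logarithm is no longer positive.
    set g : ℕ → ℝ := fun j => max (Real.log (x / ((j : ℝ) + 1))) 0 with hg
    have key : ∀ j ∈ Finset.range ⌊x⌋₊, (g j ^ (d + 1) - g (j + 1) ^ (d + 1)) /
        (d + 1).factorial ≤ ((j : ℝ) + 1)⁻¹ * crossSum d (x / ((j : ℝ) + 1)) := by
      intro j hj
      have hj' : (j : ℝ) + 1 ≤ x := lt_floor_iff.1 (Finset.mem_range.1 hj)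
      have h1 : 1 ≤ x / ((j : ℝ) + 1) := by rwa [le_div_iff₀ (by positivity), one_mul]
      have h2 : g j = Real.log (x / ((j : ℝ) + 1)) := max_eq_left (Real.log_nonneg h1)
      have h3 : g (j + 1) ≤ g j := by
        simp only [hg]
        refine max_le_max ?_ le_rfl
        refine Real.log_le_log (by positivity) ?_
        push_cast
        gcongr
        linarith
      have h4 : g j - g (j + 1) ≤ ((j : ℝ) + 1)⁻¹ := by
        have : Real.log (x / ((j : ℝ) + 1 + 1)) ≤ g (j + 1) := by
          simp [hg]
        rw [h2]
        have h5 : Real.log (((j : ℝ) + 1 + 1) / (j + 1)) ≤ ((j : ℝ) + 1 + 1) / (j + 1) - 1 :=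
          Real.log_le_sub_one_of_pos (by positivity)
        rw [Real.log_div (by positivity) (by positivity)] at h5 this ⊢
        have h6 : ((j : ℝ) + 1 + 1) / (j + 1) - 1 = ((j : ℝ) + 1)⁻¹ := by field_simp; ring
        linarith
      have h0 : 0 ≤ g (j + 1) := le_max_right _ _
      have h7 := pow_succ_sub_pow_succ_le d h0 h3
      have h8 := ih h1
      rw [← h2] at h8
      have h9 : (0 : ℝ) < d.factorial := by positivity
      rw [div_le_iff₀ h9] at h8
      rw [div_le_iff₀ (by positivity), Nat.factorial_succ]
      push_cast
      have hgp : 0 ≤ g j ^ d := pow_nonneg (h0.trans h3) _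
      calc g j ^ (d + 1) - g (j + 1) ^ (d + 1) ≤ (d + 1) * ((g j - g (j + 1)) * g j ^ d) := h7
        _ ≤ (d + 1) * (((j : ℝ) + 1)⁻¹ * (crossSum d (x / ((j : ℝ) + 1)) * d.factorial)) := by
          gcongr
        _ = _ := by ring
    rw [crossSum_succ]
    refine le_trans ?_ (Finset.sum_le_sum key)
    rw [← Finset.sum_div, Finset.sum_range_sub']
    have e1 : g 0 = Real.log x := by
      simp only [hg]
      norm_num
      exact Real.log_nonneg hx
    have e2 : g ⌊x⌋₊ = 0 := by
      simp only [hg]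
      refine max_eq_right (Real.log_nonpos (by positivity) ?_)
      rw [div_le_one (by positivity)]
      exact (Nat.lt_floor_add_one x).le
    rw [e1, e2]
    simp

/-- For `j ≥ 1` the slices telescope as in the lower bound, now because the logarithm drops by at
least `1 / (j + 1)` from `j - 1` to `j`. The slice `j = 0` has no predecessor; the shift by the
dimension pays for it. -/
lemma crossSum_le (d : ℕ) :
    ∀ {x : ℝ}, 1 ≤ x → crossSum d x ≤ (Real.log x + d) ^ d / d.factorial := by
  induction d with
  | zero => intro x hx; simp [crossSum_zero hx]
  | succ d ih =>
    intro x hx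
    have hx0 : 0 < x := by linarith
    set u : ℕ → ℝ := fun j => Real.log (x / ((j : ℝ) + 1)) + d with hu
    have hpos : ∀ j, j < ⌊x⌋₊ → 0 ≤ u j := by
      intro j hj
      have h1 : 1 ≤ x / ((j : ℝ) + 1) := by
        rw [le_div_iff₀ (by positivity), one_mul]; exact lt_floor_iff.1 hj
      have := Real.log_nonneg h1
      simp only [hu]; positivity
    have hle : ∀ j ∈ Finset.range ⌊x⌋₊,
        ((j : ℝ) + 1)⁻¹ * crossSum d (x / ((j : ℝ) + 1)) ≤
          ((j : ℝ) + 1)⁻¹ * u j ^ d / d.factorial := by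
      intro j hj
      have hj' : (j : ℝ) + 1 ≤ x := lt_floor_iff.1 (Finset.mem_range.1 hj)
      have h1 : 1 ≤ x / ((j : ℝ) + 1) := by rwa [le_div_iff₀ (by positivity), one_mul]
      rw [mul_div_assoc]
      exact mul_le_mul_of_nonneg_left (ih h1) (by positivity)
    obtain ⟨m, hm⟩ : ∃ m, ⌊x⌋₊ = m + 1 :=
      Nat.exists_eq_succ_of_ne_zero (Nat.floor_pos.2 hx).ne'
    have hstep : ∀ j ∈ Finset.range m, (((j + 1 : ℕ) : ℝ) + 1)⁻¹ * u (j + 1) ^ d / d.factorial ≤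
        (u j ^ (d + 1) - u (j + 1) ^ (d + 1)) / (d + 1).factorial := by
      intro j hj
      have hj2 : j + 1 < ⌊x⌋₊ := by have := Finset.mem_range.1 hj; omega
      have h0 := hpos _ hj2
      have h4 : ((j : ℝ) + 1 + 1)⁻¹ ≤ u j - u (j + 1) := by
        have h5 : Real.log (((j : ℝ) + 1) / (j + 1 + 1)) ≤ ((j : ℝ) + 1) / (j + 1 + 1) - 1 :=
          Real.log_le_sub_one_of_pos (by positivity)
        simp only [hu]
        push_cast
        rw [Real.log_div (by positivity) (by positivity)] at h5 ⊢
        rw [Real.log_div (by positivity) (by positivity)]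
        have h6 : ((j : ℝ) + 1) / (j + 1 + 1) - 1 = -((j : ℝ) + 1 + 1)⁻¹ := by field_simp; ring
        linarith
      have h3 : u (j + 1) ≤ u j := by
        have : 0 ≤ ((j : ℝ) + 1 + 1)⁻¹ := by positivity
        linarith
      have h7 := le_pow_succ_sub_pow_succ d h0 h3
      rw [Nat.factorial_succ, div_le_div_iff₀ (by positivity) (by positivity)]
      push_cast
      have : 0 ≤ u (j + 1) ^ d := pow_nonneg h0 _
      calc ((j : ℝ) + 1 + 1)⁻¹ * u (j + 1) ^ d * ((d + 1) * d.factorial)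
          ≤ (u j - u (j + 1)) * u (j + 1) ^ d * ((d + 1) * d.factorial) := by gcongr
        _ = (d + 1) * ((u j - u (j + 1)) * u (j + 1) ^ d) * d.factorial := by ring
        _ ≤ _ := by gcongr
    rw [crossSum_succ]
    refine (Finset.sum_le_sum hle).trans ?_
    rw [hm, Finset.sum_range_succ']
    refine (add_le_add_left (Finset.sum_le_sum hstep) _).trans ?_
    rw [← Finset.sum_div, Finset.sum_range_sub']
    have e1 : u 0 = Real.log x + d := by simp [hu]
    have hu0 : 0 ≤ u 0 := hpos 0 (by omega)
    have hum : 0 ≤ u m ^ (d + 1) := pow_nonneg (hpos m (by omega)) _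
    -- Raising the shift from `d` to `d + 1` gains at least `(d + 1) * u 0 ^ d`, which is the
    -- contribution of the slice `j = 0`.
    have h8 := le_pow_succ_sub_pow_succ d hu0 (by linarith : u 0 ≤ u 0 + 1)
    have e2 : Real.log x + ((d + 1 : ℕ) : ℝ) = u 0 + 1 := by rw [e1]; push_cast; ring
    rw [e2, Nat.factorial_succ]
    push_cast
    rw [div_add_div _ _ (by positivity) (by positivity), div_le_div_iff₀ (by positivity)
      (by positivity)]
    have hf : (0 : ℝ) < d.factorial := by positivity
    have : u 0 ^ (d + 1) - u m ^ (d + 1) + (d + 1) * u 0 ^ d ≤ (u 0 + 1) ^ (d + 1) := by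
      nlinarith
    calc _ = (u 0 ^ (d + 1) - u m ^ (d + 1) + (d + 1) * u 0 ^ d) *
        (d.factorial * ((d + 1) * d.factorial)) := by ring
      _ ≤ (u 0 + 1) ^ (d + 1) * (d.factorial * ((d + 1) * d.factorial)) := by gcongr
      _ = _ := by ring

lemma card_hyperbolicCross_succ (d : ℕ) (x : ℝ) :
    ((hyperbolicCross (d + 1) x).card : ℝ) =
      ∑ k ∈ hyperbolicCross d x, (⌊x / crossProd k⌋₊ : ℝ) := by
  have h := sum_hyperbolicCross_succ' (d := d) x fun _ => 1
  simpa using h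

lemma card_hyperbolicCross_succ_le {d : ℕ} {x : ℝ} (hx : 0 ≤ x) :
    ((hyperbolicCross (d + 1) x).card : ℝ) ≤ x * crossSum d x := by
  rw [card_hyperbolicCross_succ, crossSum, Finset.mul_sum]
  refine Finset.sum_le_sum fun k _ => ?_
  rw [← div_eq_mul_inv]
  exact Nat.floor_le (div_nonneg hx (crossProd_pos k).le)

/-- Each floor loses at most one, and there is one floor per point of the lower-dimensional cross.
-/
lemma le_card_hyperbolicCross_succ (d : ℕ) (x : ℝ) :
    x * crossSum d x - (hyperbolicCross d x).card ≤ (hyperbolicCross (d + 1) x).card := by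
  rw [card_hyperbolicCross_succ, crossSum, Finset.mul_sum, Finset.card_eq_sum_ones]
  push_cast
  rw [← Finset.sum_sub_distrib]
  refine Finset.sum_le_sum fun k _ => ?_
  rw [← div_eq_mul_inv]
  exact (Nat.sub_one_lt_floor _).le

/-- The sum is `log (y ^ m / m!)`, and `y ^ m / m!` is a single term of the series of `exp y`. -/
lemma sum_log_div_le {y : ℝ} (hy : 0 < y) (m : ℕ) :
    ∑ j ∈ Finset.range m, Real.log (y / ((j : ℝ) + 1)) ≤ y := by
  have h := Real.pow_div_factorial_le_exp y hy.le m
  have h0 : (m.factorial : ℝ) = ∏ j ∈ Finset.range m, ((j : ℝ) + 1) := by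
    rw [← Finset.prod_range_add_one_eq_factorial]
    push_cast
    rfl
  have h1 : ∑ j ∈ Finset.range m, Real.log (y / ((j : ℝ) + 1)) =
      Real.log (y ^ m / m.factorial) := by
    rw [← Real.log_prod fun j _ => by positivity, Finset.prod_div_distrib, h0]
    simp
  rw [h1, ← Real.log_exp y]
  refine Real.log_le_log (by rw [Real.log_exp]; positivity) (by rwa [Real.log_exp])

/-- Bounds the logarithmic volume of the ellipsoid in the entropy estimate by the same quantity that
bounds the number of its coordinates. -/
lemma sum_log_div_crossProd_le (d : ℕ) {x : ℝ} (hx : 0 < x) :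
    ∑ k ∈ hyperbolicCross (d + 1) x, Real.log (x / crossProd k) ≤ x * crossSum d x := by
  rw [sum_hyperbolicCross_succ', crossSum, Finset.mul_sum]
  refine Finset.sum_le_sum fun k _ => ?_
  refine le_trans (le_of_eq ?_)
    (sum_log_div_le (div_pos hx (crossProd_pos k)) ⌊x / crossProd k⌋₊)
  refine Finset.sum_congr rfl fun j _ => ?_
  rw [crossProd_cons, div_div, mul_comm]

/-! ### Asymptotics of the counting function and of its inverse -/

lemma tendsto_crossSum (d : ℕ) :
    Tendsto (fun x => crossSum d x / Real.log x ^ d) atTop (𝓝 (1 / (d.factorial : ℝ))) := by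
  have h1 : Tendsto (fun x : ℝ => (1 + d * (Real.log x)⁻¹) ^ d / (d.factorial : ℝ)) atTop
      (𝓝 (1 / (d.factorial : ℝ))) := by
    have h : Tendsto (fun x : ℝ => (1 + d * (Real.log x)⁻¹) ^ d / (d.factorial : ℝ)) atTop
        (𝓝 ((1 + d * 0) ^ d / (d.factorial : ℝ))) :=
      ((((tendsto_inv_atTop_zero.comp Real.tendsto_log_atTop).const_mul _).const_add 1).pow
        d).div_const _
    simpa using h
  refine tendsto_of_tendsto_of_tendsto_of_le_of_le' tendsto_const_nhds h1 ?_ ?_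
  · filter_upwards [eventually_gt_atTop 1] with x hx
    have := Real.log_pos hx
    rw [le_div_iff₀ (by positivity), one_div_mul_eq_div]
    exact log_pow_div_factorial_le_crossSum d hx.le
  · filter_upwards [eventually_gt_atTop 1] with x hx
    have := Real.log_pos hx
    rw [div_le_iff₀ (by positivity), div_mul_eq_mul_div, ← mul_pow]
    refine (crossSum_le d hx.le).trans (le_of_eq ?_)
    congr 2
    field_simp

/-- The error from the floors lives in one dimension less, hence is smaller than the main term by a
factor `log x`. -/
lemma tendsto_card_hyperbolicCross_div_zero (e : ℕ) :
    Tendsto (fun x => ((hyperbolicCross e x).card : ℝ) / (x * Real.log x ^ e)) atTop (𝓝 0) := by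
  cases e with
  | zero =>
    refine tendsto_inv_atTop_zero.congr' ?_
    filter_upwards [eventually_ge_atTop 1] with x hx
    simp [hyperbolicCross_zero hx]
  | succ e =>
    have h : Tendsto (fun x => crossSum e x / Real.log x ^ e * (Real.log x)⁻¹) atTop (𝓝 0) := by
      simpa using (tendsto_crossSum e).mul (tendsto_inv_atTop_zero.comp Real.tendsto_log_atTop)
    refine tendsto_of_tendsto_of_tendsto_of_le_of_le' tendsto_const_nhds h ?_ ?_
    · filter_upwards [eventually_gt_atTop 1] with x hx
      have := Real.log_pos hx
      positivity
    · filter_upwards [eventually_gt_atTop 1] with x hx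
      have := Real.log_pos hx
      rw [div_le_iff₀ (by positivity)]
      refine (card_hyperbolicCross_succ_le (by linarith)).trans (le_of_eq ?_)
      field_simp
      ring

lemma tendsto_card_hyperbolicCross (e : ℕ) :
    Tendsto (fun x => ((hyperbolicCross (e + 1) x).card : ℝ) / (x * Real.log x ^ e)) atTop
      (𝓝 (1 / (e.factorial : ℝ))) := by
  have h := (tendsto_crossSum e).sub (tendsto_card_hyperbolicCross_div_zero e)
  rw [sub_zero] at h
  refine tendsto_of_tendsto_of_tendsto_of_le_of_le' h (tendsto_crossSum e) ?_ ?_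
  · filter_upwards [eventually_gt_atTop 1] with x hx
    have := Real.log_pos hx
    rw [le_div_iff₀ (by positivity)]
    refine le_trans (le_of_eq ?_) (le_card_hyperbolicCross_succ e x)
    field_simp
  · filter_upwards [eventually_gt_atTop 1] with x hx
    have := Real.log_pos hx
    rw [div_le_iff₀ (by positivity)]
    refine (card_hyperbolicCross_succ_le (by linarith)).trans (le_of_eq ?_)
    field_simp

lemma tendsto_log_sub_one_div_log :
    Tendsto (fun x => Real.log (x - 1) / Real.log x) atTop (𝓝 1) := by
  have h : Tendsto (fun x : ℝ => 1 + Real.log (1 - x⁻¹) * (Real.log x)⁻¹) atTop (𝓝 1) := by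
    have h1 : Tendsto (fun x : ℝ => 1 - x⁻¹) atTop (𝓝 1) := by
      simpa using tendsto_inv_atTop_zero.const_sub (1 : ℝ)
    have h2 := h1.log one_ne_zero
    simpa using (h2.mul (tendsto_inv_atTop_zero.comp Real.tendsto_log_atTop)).const_add 1
  refine h.congr' ?_
  filter_upwards [eventually_gt_atTop 1] with x hx
  have := Real.log_pos hx
  have h3 : x - 1 = x * (1 - x⁻¹) := by field_simp
  have h4 : 0 < 1 - x⁻¹ := by
    rw [sub_pos]; exact inv_lt_one_of_one_lt₀ hx
  rw [h3, Real.log_mul (by positivity) h4.ne']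
  field_simp

/-- The minimality of `crossValue` speaks about the cross at `m - 1`, which therefore needs the same
asymptotics. -/
lemma tendsto_card_hyperbolicCross_sub_one (e : ℕ) :
    Tendsto (fun x => ((hyperbolicCross (e + 1) (x - 1)).card : ℝ) / (x * Real.log x ^ e)) atTop
      (𝓝 (1 / (e.factorial : ℝ))) := by
  have h0 : Tendsto (fun x : ℝ => x - 1) atTop atTop := tendsto_atTop_add_const_right _ _ tendsto_id
  have h1 := (tendsto_card_hyperbolicCross e).comp h0
  have h2 : Tendsto (fun x : ℝ => 1 - x⁻¹) atTop (𝓝 1) := by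
    simpa using tendsto_inv_atTop_zero.const_sub (1 : ℝ)
  have h3 := (h1.mul h2).mul (tendsto_log_sub_one_div_log.pow e)
  simp only [mul_one, one_pow] at h3
  refine h3.congr' ?_
  filter_upwards [eventually_gt_atTop 2] with x hx
  have h4 := Real.log_pos (by linarith : 1 < x)
  have h5 := Real.log_pos (by linarith : 1 < x - 1)
  have h6 : 0 < x - 1 := by linarith
  simp only [Function.comp, div_pow]
  field_simp

/-- The points on the first coordinate axis alone suffice. -/
lemma floor_le_card_hyperbolicCross (e : ℕ) {x : ℝ} (hx : 1 ≤ x) :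
    ⌊x⌋₊ ≤ (hyperbolicCross (e + 1) x).card := by
  have h := card_hyperbolicCross_succ e x
  have h0 : (0 : Fin e → ℕ) ∈ hyperbolicCross e x := by
    rw [mem_hyperbolicCross]; simpa [crossProd] using hx
  have h1 := Finset.single_le_sum (f := fun k => (⌊x / crossProd k⌋₊ : ℝ))
    (fun k _ => Nat.cast_nonneg _) h0
  rw [← h] at h1
  simpa [crossProd] using h1

lemma exists_le_card_hyperbolicCross (e n : ℕ) :
    ∃ m : ℕ, n ≤ (hyperbolicCross (e + 1) (m : ℝ)).card := by
  -- The witness `n + 1` rather than `n` keeps the parameter at least `1` when `n = 0`.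
  refine ⟨n + 1, le_trans ?_ (floor_le_card_hyperbolicCross e (by simp))⟩
  rw [Nat.floor_natCast]
  exact n.le_succ

open Classical in
/-- The `n`-th smallest value of `∏_j (k_j + 1)` over the multi-indices `k` of length `e + 1`. -/
noncomputable def crossValue (e n : ℕ) : ℕ := Nat.find (exists_le_card_hyperbolicCross e n)

lemma le_card_hyperbolicCross_crossValue (e n : ℕ) :
    n ≤ (hyperbolicCross (e + 1) (crossValue e n : ℝ)).card := by
  classical exact Nat.find_spec (exists_le_card_hyperbolicCross e n)

lemma card_hyperbolicCross_lt {e n m : ℕ} (h : m < crossValue e n) :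
    (hyperbolicCross (e + 1) (m : ℝ)).card < n := by
  classical exact not_le.1 (Nat.find_min (exists_le_card_hyperbolicCross e n) h)

lemma crossValue_pos {e n : ℕ} (hn : 1 ≤ n) : 1 ≤ crossValue e n := by
  by_contra! h
  have := le_card_hyperbolicCross_crossValue e n
  rw [Nat.lt_one_iff.1 h, hyperbolicCross_eq_empty (by simp)] at this
  simp at this
  omega

lemma tendsto_crossValue (e : ℕ) : Tendsto (crossValue e) atTop atTop := by
  refine tendsto_atTop.2 fun b => ?_
  filter_upwards [eventually_gt_atTop (hyperbolicCross (e + 1) (b : ℝ)).card] with n hn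
  by_contra! h
  have h1 := le_card_hyperbolicCross_crossValue e n
  have h2 := Finset.card_le_card (hyperbolicCross_mono (d := e + 1)
    (Nat.cast_le (α := ℝ).2 h.le))
  omega

/-- By minimality, `n` lies between the numbers of points of the crosses at `m - 1` and `m`, where
`m = crossValue e n`; both have the same asymptotics in `m`. -/
lemma tendsto_div_crossValue (e : ℕ) :
    Tendsto (fun n : ℕ => (n : ℝ) / (crossValue e n * Real.log (crossValue e n) ^ e)) atTop
      (𝓝 (1 / (e.factorial : ℝ))) := by
  have hm : Tendsto (fun n => (crossValue e n : ℝ)) atTop atTop :=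
    tendsto_natCast_atTop_atTop.comp (tendsto_crossValue e)
  refine tendsto_of_tendsto_of_tendsto_of_le_of_le'
    ((tendsto_card_hyperbolicCross_sub_one e).comp hm)
    ((tendsto_card_hyperbolicCross e).comp hm) ?_ ?_
  · filter_upwards [(tendsto_crossValue e).eventually_gt_atTop 1] with n hn
    have h1 : (1 : ℝ) < crossValue e n := by exact_mod_cast hn
    have := Real.log_pos h1
    have h2 := card_hyperbolicCross_lt (Nat.sub_lt (by omega) one_pos : crossValue e n - 1 < _)
    rw [Nat.cast_sub hn.le, Nat.cast_one] at h2
    simp only [Function.comp]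
    gcongr
  · filter_upwards [(tendsto_crossValue e).eventually_gt_atTop 1] with n hn
    have h1 : (1 : ℝ) < crossValue e n := by exact_mod_cast hn
    have := Real.log_pos h1
    simp only [Function.comp]
    gcongr
    exact le_card_hyperbolicCross_crossValue e n

/-- The logarithm of the preceding limit says that `log n - log m - e * log (log m)` converges;
dividing by `log m` leaves the ratio. -/
lemma tendsto_log_div_log_crossValue (e : ℕ) :
    Tendsto (fun n : ℕ => Real.log n / Real.log (crossValue e n)) atTop (𝓝 1) := by
  have hm : Tendsto (fun n => (crossValue e n : ℝ)) atTop atTop :=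
    tendsto_natCast_atTop_atTop.comp (tendsto_crossValue e)
  have hl := Real.tendsto_log_atTop.comp hm
  have h1 := (tendsto_div_crossValue e).log (by positivity)
  have h2 := h1.mul (tendsto_inv_atTop_zero.comp hl)
  have h3 := (Real.isLittleO_log_id_atTop.tendsto_div_nhds_zero.comp hl).const_mul (e : ℝ)
  have h4 := (h2.add h3).const_add 1
  simp only [mul_zero, add_zero] at h4
  refine h4.congr' ?_
  filter_upwards [(tendsto_crossValue e).eventually_gt_atTop 1, eventually_ge_atTop 1]
    with n hn hn1
  have h1 : (1 : ℝ) < crossValue e n := by exact_mod_cast hn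
  have h5 := Real.log_pos h1
  have h6 : (0 : ℝ) < n := by exact_mod_cast hn1
  simp only [Function.comp, id]
  rw [Real.log_div (by positivity) (by positivity), Real.log_mul (by positivity) (by positivity),
    Real.log_pow]
  field_simp
  ring

/-- The asymptotics of the singular numbers of the embedding. -/
lemma tendsto_crossValue_rpow (e : ℕ) (α : ℝ) (hα : 0 < α) :
    Tendsto (fun n : ℕ => (crossValue e n : ℝ) ^ (-(α / 2)) /
      ((n : ℝ) ^ (-(α / 2)) * Real.log n ^ (α * e / 2))) atTop
      (𝓝 ((1 / (e.factorial : ℝ)) ^ (α / 2))) := by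
  -- The factor `(log m / log n) ^ e` replaces `log m` by `log n` in the denominator, so the product
  -- is `n / (m * (log n) ^ e)`.
  have h1 := (tendsto_div_crossValue e).mul
    (((tendsto_log_div_log_crossValue e).inv₀ one_ne_zero).pow e)
  simp only [inv_one, one_pow, mul_one] at h1
  refine (h1.rpow_const (p := α / 2) (Or.inr (by positivity))).congr' ?_
  filter_upwards [(tendsto_crossValue e).eventually_gt_atTop 1, eventually_ge_atTop 2]
    with n hn hn1
  have h1 : (1 : ℝ) < crossValue e n := by exact_mod_cast hn
  have h5 := Real.log_pos h1
  have h6 : (1 : ℝ) < n := by exact_mod_cast hn1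
  have h7 := Real.log_pos h6
  have h8 : α * e / 2 = e * (α / 2) := by ring
  rw [h8, Real.rpow_mul h7.le, Real.rpow_neg (by positivity), Real.rpow_neg (by positivity),
    Real.rpow_natCast, ← Real.inv_rpow (by positivity), ← Real.inv_rpow (by positivity),
    ← Real.mul_rpow (by positivity) (by positivity), ← Real.div_rpow (by positivity)
    (by positivity), inv_div, div_pow]
  congr 1
  field_simp

/-! ### Orthonormality of the Hermite polynomials -/

lemma integrable_polynomial_gaussianReal (p : Polynomial ℝ) :
    Integrable (fun t => p.eval t) (gaussianReal 0 1) := by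
  simp_rw [Polynomial.eval_eq_sum_range]
  refine integrable_finsetSum _ fun i _ => Integrable.const_mul ?_ _
  rcases Nat.eq_zero_or_pos i with rfl | hi
  · simp
  · have h := (memLp_id_gaussianReal (μ := 0) (v := 1) (i : NNReal)).integrable_norm_rpow
      (by simpa using hi.ne') (by simp)
    refine (integrable_norm_iff (by fun_prop)).1 ?_
    simpa [norm_pow] using h

lemma integrable_gaussianPDFReal_mul_polynomial (p : Polynomial ℝ) :
    Integrable (fun t => gaussianPDFReal 0 1 t * p.eval t) := by
  have h := integrable_polynomial_gaussianReal p
  rw [gaussianReal_of_var_ne_zero 0 one_ne_zero,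
    integrable_withDensity_iff_integrable_smul' (measurable_gaussianPDF 0 1)
      (ae_of_all _ fun _ => gaussianPDF_lt_top)] at h
  simpa using h

/-- The expectation of a polynomial under the standard Gaussian measure. -/
noncomputable def gaussianExpectation (p : Polynomial ℝ) : ℝ := ∫ t, p.eval t ∂(gaussianReal 0 1)

lemma gaussianExpectation_sub (p q : Polynomial ℝ) :
    gaussianExpectation (p - q) = gaussianExpectation p - gaussianExpectation q := by
  simp only [gaussianExpectation, Polynomial.eval_sub]
  exact integral_sub (integrable_polynomial_gaussianReal p) (integrable_polynomial_gaussianReal q)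

/-- Gaussian integration by parts: the density `φ` satisfies `φ' = -t * φ`, so `φ * (p' - t * p)` is
the derivative of the integrable function `φ * p` and has integral zero. -/
lemma gaussianExpectation_X_mul (p : Polynomial ℝ) :
    gaussianExpectation (Polynomial.X * p) = gaussianExpectation p.derivative := by
  have h : gaussianExpectation (p.derivative - Polynomial.X * p) = 0 := by
    rw [gaussianExpectation, integral_gaussianReal_eq_integral_smul one_ne_zero]
    refine integral_eq_zero_of_hasDerivAt_of_integrable
      (f := fun t => gaussianPDFReal 0 1 t * p.eval t) (fun t => ?_)
      (integrable_gaussianPDFReal_mul_polynomial _) (integrable_gaussianPDFReal_mul_polynomial p)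
    have h1 : HasDerivAt (gaussianPDFReal 0 1) (gaussianPDFReal 0 1 t * (-t)) t := by
      have h2 : HasDerivAt (fun x : ℝ => -(x - 0) ^ 2 / (2 * ((1 : NNReal) : ℝ))) (-t) t := by
        have := (((hasDerivAt_id t).sub_const 0).pow 2).neg.div_const (2 * ((1 : NNReal) : ℝ))
        refine this.congr_deriv ?_
        simp
        ring
      have h3 := (h2.exp).const_mul (√(2 * Real.pi * ((1 : NNReal) : ℝ)))⁻¹
      refine h3.congr_deriv ?_
      simp only [gaussianPDFReal]
      ring
    refine (h1.mul (p.hasDerivAt t)).congr_deriv ?_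
    simp only [Polynomial.eval_sub, Polynomial.eval_mul, Polynomial.eval_X, smul_eq_mul]
    ring
  rw [gaussianExpectation_sub] at h
  linarith

/-- The Hermite polynomial of degree `n` with real coefficients. -/
noncomputable def realHermite (n : ℕ) : Polynomial ℝ :=
  (Polynomial.hermite n).map (Int.castRingHom ℝ)

lemma realHermite_succ (n : ℕ) :
    realHermite (n + 1) = Polynomial.X * realHermite n - (realHermite n).derivative := by
  simp [realHermite, Polynomial.hermite_succ, Polynomial.derivative_map]

/-- The recursion makes `X - D` raise the degree, and integration by parts makes it the adjoint of
the derivative `D`. Orthogonality and normalization follow by comparing degrees. -/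
lemma gaussianExpectation_realHermite_mul (n : ℕ) (p : Polynomial ℝ) :
    gaussianExpectation (realHermite n * p) =
      gaussianExpectation (Polynomial.derivative^[n] p) := by
  induction n generalizing p with
  | zero => simp [realHermite]
  | succ n ih =>
    rw [Function.iterate_succ_apply, ← ih, realHermite_succ, sub_mul, mul_assoc,
      gaussianExpectation_sub, gaussianExpectation_X_mul, ← gaussianExpectation_sub,
      Polynomial.derivative_mul]
    congr 1
    ring

lemma natDegree_realHermite (n : ℕ) : (realHermite n).natDegree = n := by
  rw [realHermite, (Polynomial.hermite_monic n).natDegree_map, Polynomial.natDegree_hermite]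

lemma gaussianExpectation_realHermite_mul_of_lt {m n : ℕ} (h : m < n) :
    gaussianExpectation (realHermite n * realHermite m) = 0 := by
  rw [gaussianExpectation_realHermite_mul, Polynomial.iterate_derivative_eq_zero
    (by rwa [natDegree_realHermite])]
  simp [gaussianExpectation]

lemma gaussianExpectation_realHermite_sq (n : ℕ) :
    gaussianExpectation (realHermite n * realHermite n) = n.factorial := by
  have h : Polynomial.derivative^[n] (realHermite n) = Polynomial.C (n.factorial : ℝ) := by
    have h1 : (Polynomial.derivative^[n] (realHermite n)).natDegree = 0 := by
      have := Polynomial.natDegree_iterate_derivative (realHermite n) n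
      rw [natDegree_realHermite] at this
      omega
    rw [Polynomial.eq_C_of_natDegree_eq_zero h1, Polynomial.coeff_iterate_derivative]
    simp [Nat.descFactorial_self, realHermite]
  rw [gaussianExpectation_realHermite_mul, h]
  simp [gaussianExpectation]

lemma hermiteOne_eq_eval (k : ℕ) (t : ℝ) :
    hermiteOne k t = (realHermite k).eval t / √(k.factorial : ℝ) := by
  rw [hermiteOne, realHermite, ← algebraMap_int_eq, Polynomial.eval_map_algebraMap]

lemma integral_hermiteOne_mul (k l : ℕ) :
    ∫ t, hermiteOne k t * hermiteOne l t ∂(gaussianReal 0 1) = if k = l then 1 else 0 := by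
  have h : ∫ t, hermiteOne k t * hermiteOne l t ∂(gaussianReal 0 1) =
      gaussianExpectation (realHermite k * realHermite l) /
        (√(k.factorial : ℝ) * √(l.factorial : ℝ)) := by
    rw [gaussianExpectation, ← integral_div]
    refine integral_congr_ae (ae_of_all _ fun t => ?_)
    simp only [hermiteOne_eq_eval, Polynomial.eval_mul]
    rw [div_mul_div_comm]
  rw [h]
  rcases lt_trichotomy k l with hkl | rfl | hkl
  · rw [mul_comm, gaussianExpectation_realHermite_mul_of_lt hkl, if_neg hkl.ne, zero_div]
  · rw [gaussianExpectation_realHermite_sq, if_pos rfl, Real.mul_self_sqrt (by positivity),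
      div_self (by positivity)]
  · rw [gaussianExpectation_realHermite_mul_of_lt hkl, if_neg hkl.ne', zero_div]

lemma integral_hermiteMulti_mul {d : ℕ} (k l : Fin d → ℕ) :
    ∫ x, hermiteMulti k x * hermiteMulti l x ∂(gaussianMeasure d) = if k = l then 1 else 0 := by
  rw [gaussianMeasure, ← map_pi_eq_stdGaussian, integral_map (by fun_prop)
    (f := fun x => hermiteMulti k x * hermiteMulti l x)
    ((continuous_hermiteMulti k).mul (continuous_hermiteMulti l)).aestronglyMeasurable]
  have h : ∀ x : Fin d → ℝ, hermiteMulti k (WithLp.toLp 2 x) * hermiteMulti l (WithLp.toLp 2 x) =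
      ∏ j, (hermiteOne (k j) (x j) * hermiteOne (l j) (x j)) := by
    intro x
    simp [hermiteMulti, Finset.prod_mul_distrib]
  simp only [h]
  rw [integral_fintype_prod_eq_prod
    (f := fun j t => hermiteOne (k j) t * hermiteOne (l j) t)]
  simp only [integral_hermiteOne_mul]
  split_ifs with hkl
  · simp [hkl]
  · obtain ⟨j, hj⟩ := Function.ne_iff.1 hkl
    exact Finset.prod_eq_zero (Finset.mem_univ j) (if_neg hj)

lemma hermiteCoeff_hermiteL2 (𝕜 : Type*) [RCLike 𝕜] {d : ℕ} (k l : Fin d → ℕ) :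
    hermiteCoeff (hermiteL2 𝕜 k) l = if k = l then 1 else 0 := by
  have h : hermiteCoeff (hermiteL2 𝕜 k) l =
      ∫ x, ((hermiteMulti k x * hermiteMulti l x : ℝ) : 𝕜) ∂(gaussianMeasure d) := by
    refine integral_congr_ae ?_
    filter_upwards [(memLp_ofReal_hermiteMulti 𝕜 k).coeFn_toLp] with x hx
    rw [hermiteL2, hx, RCLike.ofReal_mul]
  rw [h, integral_ofReal, integral_hermiteMulti_mul]
  split_ifs <;> simp

lemma orthonormal_hermiteL2 (𝕜 : Type*) [RCLike 𝕜] (d : ℕ) :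
    Orthonormal 𝕜 (hermiteL2 𝕜 : (Fin d → ℕ) → GaussianL2 𝕜 d) := by
  classical
  rw [orthonormal_iff_ite]
  intro k l
  rw [← hermiteCoeff_eq_inner, hermiteCoeff_hermiteL2]
  simp [eq_comm]

/-! ### Quantities of operators into inner product spaces -/

section SNumberBounds

variable {𝕜 : Type*} [RCLike 𝕜]
variable {X : Type*} [NormedAddCommGroup X] [NormedSpace 𝕜 X]
variable {Y : Type*} [NormedAddCommGroup Y] [InnerProductSpace 𝕜 Y]

/-- Rank-nullity, the common source of the lower bounds for approximation, Gelfand and Kolmogorov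
numbers and of the upper bound for Bernstein numbers. -/
lemma exists_ne_zero_map_eq_zero {V : Type*} [AddCommGroup V] [Module 𝕜 V]
    [FiniteDimensional 𝕜 V] {Z : Type*} [AddCommGroup Z] [Module 𝕜 Z] {n : ℕ}
    (hV : Module.finrank 𝕜 V = n) (B : V →ₗ[𝕜] Z) (hB : Module.finrank 𝕜 B.range < n) :
    ∃ v : V, v ≠ 0 ∧ B v = 0 := by
  have h := LinearMap.finrank_range_add_finrank_ker B
  have h1 : B.ker ≠ ⊥ := by
    rintro h2
    rw [h2, finrank_bot] at h
    omega
  obtain ⟨v, hv, hv0⟩ := (Submodule.ne_bot_iff _).1 h1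
  exact ⟨v, hv0, hv⟩

lemma finrank_range_lt_of_rank_lt {V : Type*} [AddCommGroup V] [Module 𝕜 V]
    {Z : Type*} [AddCommGroup Z] [Module 𝕜 Z] {n : ℕ} (B : V →ₗ[𝕜] Z)
    (hZ : Module.rank 𝕜 Z < n) : Module.finrank 𝕜 B.range < n :=
  Module.finrank_lt_of_rank_lt ((LinearMap.rank_le_range B).trans_lt hZ)

/-- `T` is within `τ` of its compression to an `(n - 1)`-dimensional subspace of `Y`. -/
def IsCompressibleTo (n : ℕ) (τ : ℝ) (T : X →L[𝕜] Y) : Prop :=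
  ∃ (W : Submodule 𝕜 Y) (_ : FiniteDimensional 𝕜 W), Module.finrank 𝕜 W = n - 1 ∧
    ∀ x, ‖T x - W.orthogonalProjectionOnto (T x)‖ ≤ τ * ‖x‖

/-- `T` is bounded below by `τ` on an `n`-dimensional Euclidean subspace of `X`. -/
def IsBoundedBelowBy (n : ℕ) (τ : ℝ) (T : X →L[𝕜] Y) : Prop :=
  ∃ J : EuclideanSpace 𝕜 (Fin n) →ₗᵢ[𝕜] X, ∀ v, τ * ‖v‖ ≤ ‖T (J v)‖

variable {n : ℕ} {τ : ℝ} {T : X →L[𝕜] Y}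

lemma approximationNumber_le (hn : 1 ≤ n) (hτ : 0 ≤ τ) (h : IsCompressibleTo n τ T) :
    approximationNumber n T ≤ τ := by
  obtain ⟨W, hW, hdim, hle⟩ := h
  refine csInf_le_of_le ⟨0, ?_⟩
    ⟨W.subtypeL ∘L (W.orthogonalProjectionOnto ∘L T), ?_, rfl⟩ ?_
  · rintro _ ⟨A, -, rfl⟩
    exact norm_nonneg _
  · have h1 : (W.subtype ∘ₗ ((W.orthogonalProjectionOnto ∘L T : X →L[𝕜] W) : X →ₗ[𝕜] W)).rank ≤
        Module.rank 𝕜 W := (LinearMap.rank_comp_le_left _ _).trans (LinearMap.rank_le_domain _)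
    refine lt_of_le_of_lt h1 ?_
    rw [← Module.finrank_eq_rank, hdim]
    exact_mod_cast Nat.sub_lt hn one_pos
  · exact ContinuousLinearMap.opNorm_le_bound _ hτ hle

lemma le_approximationNumber (hn : 1 ≤ n) (h : IsBoundedBelowBy n τ T) :
    τ ≤ approximationNumber n T := by
  obtain ⟨J, hJ⟩ := h
  refine le_csInf ⟨_, 0, ?_, rfl⟩ ?_
  · simpa using Nat.lt_of_succ_le hn
  · rintro _ ⟨A, hA, rfl⟩
    obtain ⟨v, hv, hv0⟩ := exists_ne_zero_map_eq_zero (𝕜 := 𝕜) (n := n) (by simp)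
      ((A : X →ₗ[𝕜] Y).comp J.toLinearMap) (by
        refine Module.finrank_lt_of_rank_lt (lt_of_le_of_lt ?_ hA)
        exact Submodule.rank_mono (LinearMap.range_comp_le_range _ _))
    have h1 : A (J v) = 0 := hv0
    have h2 := (T - A).le_opNorm (J v)
    rw [_root_.sub_apply, h1, sub_zero, J.norm_map] at h2
    exact le_of_mul_le_mul_right ((hJ v).trans h2) (norm_pos_iff.2 hv)

/-- The kernel of the compression has codimension at most `n - 1`, and on it the compression error
is `T` itself. -/
lemma gelfandNumber_le (hn : 1 ≤ n) (hτ : 0 ≤ τ) (h : IsCompressibleTo n τ T) :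
    gelfandNumber n T ≤ τ := by
  obtain ⟨W, hW, hdim, hle⟩ := h
  set A : X →ₗ[𝕜] W := (W.orthogonalProjectionOnto ∘L T : X →L[𝕜] W).toLinearMap with hA
  have e := A.quotKerEquivRange
  have : FiniteDimensional 𝕜 (X ⧸ A.ker) := e.symm.finiteDimensional
  refine csInf_le_of_le ⟨0, ?_⟩ ⟨A.ker, ?_, rfl⟩ ?_
  · rintro _ ⟨M, -, rfl⟩
    exact norm_nonneg _
  · rw [← Module.finrank_eq_rank, e.finrank_eq, Nat.cast_lt]
    have := Submodule.finrank_le A.range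
    omega
  · refine ContinuousLinearMap.opNorm_le_bound _ hτ fun x => ?_
    have hx : W.orthogonalProjectionOnto (T x) = 0 := x.2
    have := hle x
    rw [hx] at this
    simpa using this

lemma le_gelfandNumber (hn : 1 ≤ n) (h : IsBoundedBelowBy n τ T) :
    τ ≤ gelfandNumber n T := by
  obtain ⟨J, hJ⟩ := h
  refine le_csInf ⟨_, ⊤, ?_, rfl⟩ ?_
  · rw [rank_subsingleton']
    exact_mod_cast hn
  · rintro _ ⟨M, hM, rfl⟩
    obtain ⟨v, hv, hv0⟩ := exists_ne_zero_map_eq_zero (𝕜 := 𝕜) (n := n) (by simp)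
      (M.mkQ.comp J.toLinearMap) (finrank_range_lt_of_rank_lt _ hM)
    have h1 : J v ∈ M := by simpa using hv0
    have h2 := (T.comp M.subtypeL).le_opNorm ⟨J v, h1⟩
    have h3 : ‖(⟨J v, h1⟩ : M)‖ = ‖v‖ := J.norm_map v
    rw [h3] at h2
    exact le_of_mul_le_mul_right ((hJ v).trans h2) (norm_pos_iff.2 hv)

lemma bddBelow_range_norm_sub (L : Submodule 𝕜 Y) (z : Y) :
    BddBelow (Set.range fun y : L => ‖z - y‖) :=
  ⟨0, by rintro _ ⟨y, rfl⟩; exact norm_nonneg _⟩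

lemma kolmogorovNumber_le (hτ : 0 ≤ τ) (h : IsCompressibleTo n τ T) :
    kolmogorovNumber n T ≤ τ := by
  obtain ⟨W, hW, hdim, hle⟩ := h
  have : Nonempty {x : X // ‖x‖ ≤ 1} := ⟨⟨0, by simp⟩⟩
  refine csInf_le_of_le ⟨0, ?_⟩ ⟨W, ?_, rfl⟩ ?_
  · rintro _ ⟨L, -, rfl⟩
    exact Real.iSup_nonneg fun x => Real.iInf_nonneg fun y => norm_nonneg _
  · rw [← Module.finrank_eq_rank, hdim]
  · refine ciSup_le fun x => ?_
    refine (ciInf_le (bddBelow_range_norm_sub W _) (W.orthogonalProjectionOnto (T x))).trans ?_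
    exact (hle x).trans (mul_le_of_le_one_right hτ x.2)

/-- For a competitor `L`, some nonzero vector has an image orthogonal to `L`, and by Pythagoras that
image is no closer to `L` than to `0`. The hypothesis `hY` supplies a competitor, since the infimum
of an empty set of reals is `0`. -/
lemma le_kolmogorovNumber (hn : 1 ≤ n)
    (hY : ∃ W : Submodule 𝕜 Y, Module.rank 𝕜 W = ((n - 1 : ℕ) : Cardinal))
    (h : IsBoundedBelowBy n τ T) : τ ≤ kolmogorovNumber n T := by
  obtain ⟨J, hJ⟩ := h
  obtain ⟨W, hW⟩ := hY
  refine le_csInf ⟨_, W, hW, rfl⟩ ?_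
  rintro _ ⟨L, hL, rfl⟩
  have : FiniteDimensional 𝕜 L := Module.rank_lt_aleph0_iff.1 (hL ▸ Cardinal.natCast_lt_aleph0)
  obtain ⟨v, hv, hv0⟩ := exists_ne_zero_map_eq_zero (𝕜 := 𝕜) (n := n) (by simp)
    ((L.orthogonalProjectionOnto ∘L T : X →L[𝕜] L).toLinearMap.comp J.toLinearMap)
    (finrank_range_lt_of_rank_lt _ (by
      rw [hL]; exact_mod_cast Nat.sub_lt hn one_pos))
  have hv1 : L.orthogonalProjectionOnto (T (J v)) = 0 := hv0
  rw [Submodule.orthogonalProjectionOnto_eq_zero_iff] at hv1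
  have hvn : 0 < ‖v‖ := norm_pos_iff.2 hv
  set c : 𝕜 := ((‖v‖⁻¹ : ℝ) : 𝕜) with hc
  have hcn : ‖c‖ = ‖v‖⁻¹ := by rw [hc, RCLike.norm_ofReal, abs_of_nonneg (by positivity)]
  have hx : ‖J (c • v)‖ ≤ 1 := by
    rw [J.norm_map, norm_smul, hcn, inv_mul_cancel₀ hvn.ne']
  have hbdd : BddAbove (Set.range fun x : {x : X // ‖x‖ ≤ 1} => ⨅ y : L, ‖T x - y‖) := by
    refine ⟨‖T‖, ?_⟩
    rintro _ ⟨x, rfl⟩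
    refine (ciInf_le (bddBelow_range_norm_sub L _) 0).trans ?_
    simpa using T.le_of_opNorm_le_of_le le_rfl x.2
  refine le_trans ?_ (le_ciSup hbdd ⟨J (c • v), hx⟩)
  refine le_ciInf fun y => ?_
  have h1 : τ ≤ ‖T (J (c • v))‖ := by
    have := hJ (c • v)
    rwa [norm_smul, hcn, inv_mul_cancel₀ hvn.ne', mul_one] at this
  have h2 : inner 𝕜 (T (J (c • v))) (-(y : Y)) = 0 := by
    rw [inner_neg_right, map_smul, map_smul, inner_smul_left,
      Submodule.inner_left_of_mem_orthogonal y.2 hv1]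
    simp
  have h3 := norm_add_sq_eq_norm_sq_add_norm_sq_of_inner_eq_zero _ _ h2
  rw [← sub_eq_add_neg] at h3
  refine h1.trans (abs_le_of_sq_le_sq' ?_ (norm_nonneg _)).2
  nlinarith [mul_self_nonneg ‖-(y : Y)‖]

/-- An `n`-dimensional `L` meets the kernel of a compression of rank at most `n - 1`. -/
lemma le_of_isCompressibleTo (hn : 1 ≤ n) (h : IsCompressibleTo n τ T) {L : Submodule 𝕜 X}
    (hL : Module.rank 𝕜 L = (n : Cardinal)) :
    ⨅ x : {x : X // x ∈ L ∧ x ≠ 0}, ‖T x‖ / ‖(x : X)‖ ≤ τ := by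
  obtain ⟨W, hW, hdim, hle⟩ := h
  have : FiniteDimensional 𝕜 L := Module.rank_lt_aleph0_iff.1 (hL ▸ Cardinal.natCast_lt_aleph0)
  obtain ⟨v, hv, hv0⟩ := exists_ne_zero_map_eq_zero (𝕜 := 𝕜) (n := n)
    (Module.finrank_eq_of_rank_eq hL)
    ((W.orthogonalProjectionOnto ∘L T : X →L[𝕜] W).toLinearMap.comp L.subtype)
    (by
      have := Submodule.finrank_le
        ((W.orthogonalProjectionOnto ∘L T : X →L[𝕜] W).toLinearMap.comp L.subtype).range
      omega)
  have hv1 : W.orthogonalProjectionOnto (T v) = 0 := hv0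
  have hvx : (v : X) ≠ 0 := by simpa using hv
  refine (ciInf_le ⟨0, ?_⟩ (⟨v, v.2, hvx⟩ : {x : X // x ∈ L ∧ x ≠ 0})).trans ?_
  · rintro _ ⟨x, rfl⟩
    positivity
  · have := hle v
    rw [hv1] at this
    rw [div_le_iff₀ (norm_pos_iff.2 hvx)]
    simpa using this

lemma bernsteinNumber_le (hn : 1 ≤ n) (hτ : 0 ≤ τ) (h : IsCompressibleTo n τ T) :
    bernsteinNumber n T ≤ τ := by
  refine Real.sSup_le ?_ hτ
  rintro _ ⟨L, hL, rfl⟩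
  exact le_of_isCompressibleTo hn h hL

/-- Compressibility to an arbitrary `σ` serves only to bound the set above, so that its supremum is
not the default value `0`. -/
lemma le_bernsteinNumber {σ : ℝ} (hn : 1 ≤ n) (h : IsBoundedBelowBy n τ T)
    (hT : IsCompressibleTo n σ T) : τ ≤ bernsteinNumber n T := by
  obtain ⟨J, hJ⟩ := h
  have hrank : Module.rank 𝕜 J.toLinearMap.range = (n : Cardinal) := by
    rw [← Module.finrank_eq_rank, LinearMap.finrank_range_of_inj J.injective]
    simp
  refine le_csSup_of_le ⟨σ, ?_⟩ ⟨J.toLinearMap.range, hrank, rfl⟩ ?_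
  · rintro _ ⟨L, hL, rfl⟩
    exact le_of_isCompressibleTo hn hT hL
  · have : Nonempty {x : X // x ∈ J.toLinearMap.range ∧ x ≠ 0} := by
      have h1 : J.toLinearMap.range ≠ ⊥ := by
        intro h2
        rw [h2, rank_bot] at hrank
        have : n = 0 := by exact_mod_cast hrank.symm
        omega
      obtain ⟨v, hv, hv0⟩ := (Submodule.ne_bot_iff _).1 h1
      exact ⟨⟨v, hv, hv0⟩⟩
    refine le_ciInf ?_
    rintro ⟨_, ⟨v, rfl⟩, hv⟩
    rw [le_div_iff₀ (norm_pos_iff.2 hv)]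
    have h1 : ‖J.toLinearMap v‖ = ‖v‖ := J.norm_map v
    rw [h1]
    exact hJ v

lemma IsCompressibleTo.comp {Z : Type*} [NormedAddCommGroup Z] [NormedSpace 𝕜 Z]
    (hτ : 0 ≤ τ) (h : IsCompressibleTo n τ T) {A : Z →L[𝕜] X} (hA : ‖A‖ ≤ 1) :
    IsCompressibleTo n τ (T.comp A) := by
  obtain ⟨W, hW, hdim, hle⟩ := h
  refine ⟨W, hW, hdim, fun z => (hle (A z)).trans ?_⟩
  gcongr
  simpa using A.le_of_opNorm_le hA z

lemma weylNumber_le (hn : 1 ≤ n) (hτ : 0 ≤ τ) (h : IsCompressibleTo n τ T) :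
    weylNumber n T ≤ τ := by
  refine Real.sSup_le ?_ hτ
  rintro _ ⟨A, hA, rfl⟩
  exact approximationNumber_le hn hτ (h.comp hτ hA)

lemma exists_linearIsometry_of_orthonormal {E : Type*} [NormedAddCommGroup E]
    [InnerProductSpace 𝕜 E] {ι : Type*} [Fintype ι] {v : ι → E} (hv : Orthonormal 𝕜 v) :
    ∃ J : EuclideanSpace 𝕜 ι →ₗᵢ[𝕜] E, ∀ x, J x = ∑ i, x i • v i := by
  let b := EuclideanSpace.basisFun ι 𝕜
  let f : EuclideanSpace 𝕜 ι →ₗ[𝕜] E := b.toBasis.constr 𝕜 v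
  have hf : f ∘ b.toBasis = v := by
    funext i
    exact b.toBasis.constr_basis 𝕜 _ i
  refine ⟨f.isometryOfOrthonormal (v := b.toBasis) (by simp) (by rwa [hf]), fun x => ?_⟩
  change b.toBasis.constr 𝕜 v x = _
  rw [b.toBasis.constr_apply_fintype 𝕜]
  simp [b]

variable (𝕜) in
lemma exists_linearIsometry_lp (n : ℕ) :
    Nonempty (EuclideanSpace 𝕜 (Fin n) →ₗᵢ[𝕜] lp (fun _ : ℕ => 𝕜) 2) := by
  let b : HilbertBasis ℕ 𝕜 (lp (fun _ : ℕ => 𝕜) 2) := default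
  obtain ⟨J, -⟩ := exists_linearIsometry_of_orthonormal
    (b.orthonormal.comp (Fin.val : Fin n → ℕ) Fin.val_injective)
  exact ⟨J⟩

/-- The test operator sends `ℓ₂` onto a copy of Euclidean space by the adjoint of an isometry `I`
and then into `X` by `J`. On the range of `I` the composition acts as `T ∘ J`, so the bound for
approximation numbers applies. As above, `hT` only bounds the supremum. -/
lemma le_weylNumber {σ : ℝ} (hn : 1 ≤ n) (h : IsBoundedBelowBy n τ T) (hσ : 0 ≤ σ)
    (hT : IsCompressibleTo n σ T) : τ ≤ weylNumber n T := by
  obtain ⟨J, hJ⟩ := h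
  obtain ⟨I⟩ := exists_linearIsometry_lp 𝕜 n
  set R := ContinuousLinearMap.adjoint I.toContinuousLinearMap with hR
  have hRI : ∀ v, R (I v) = v := fun v =>
    congrArg (fun B : EuclideanSpace 𝕜 (Fin n) →L[𝕜] EuclideanSpace 𝕜 (Fin n) => B v)
      I.adjoint_comp_self
  have hRn : ‖R‖ ≤ 1 := by
    rw [hR, LinearIsometryEquiv.norm_map]
    exact I.norm_toContinuousLinearMap_le
  set A := J.toContinuousLinearMap ∘L R with hA
  have hAn : ‖A‖ ≤ 1 := (ContinuousLinearMap.opNorm_comp_le _ _).trans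
    (mul_le_one₀ J.norm_toContinuousLinearMap_le (norm_nonneg _) hRn)
  refine le_csSup_of_le ⟨σ, ?_⟩ ⟨A, hAn, rfl⟩ (le_approximationNumber hn ⟨I, fun v => ?_⟩)
  · rintro _ ⟨B, hB, rfl⟩
    exact approximationNumber_le hn hσ (hT.comp hσ hB)
  · have h1 : (T.comp A) (I v) = T (J v) := by
      simp [hA, hRI]
    rw [h1]
    exact hJ v

/-- The quantities other than the entropy numbers are determined by a matching pair of bounds. -/
lemma sNumber_eq {s : SKind} (hs : s ≠ SKind.e) (hn : 1 ≤ n) (hτ : 0 ≤ τ)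
    (hT : IsCompressibleTo n τ T) (h : IsBoundedBelowBy n τ T) : sNumber s n T = τ := by
  cases s with
  | a => exact le_antisymm (approximationNumber_le hn hτ hT) (le_approximationNumber hn h)
  | b => exact le_antisymm (bernsteinNumber_le hn hτ hT) (le_bernsteinNumber hn h hT)
  | c => exact le_antisymm (gelfandNumber_le hn hτ hT) (le_gelfandNumber hn h)
  | d =>
    refine le_antisymm (kolmogorovNumber_le hτ hT) (le_kolmogorovNumber hn ?_ h)
    obtain ⟨W, hW, hdim, -⟩ := hT
    exact ⟨W, by rw [← Module.finrank_eq_rank, hdim]⟩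
  | e => exact absurd rfl hs
  | x => exact le_antisymm (weylNumber_le hn hτ hT) (le_weylNumber hn h hτ hT)

end SNumberBounds

/-! ### Covering numbers and volumes -/

section Covering

open Module (finrank)
open scoped ENNReal

variable {V : Type*} [NormedAddCommGroup V] [NormedSpace ℝ V] [FiniteDimensional ℝ V]

lemma one_le_card_mul_pow_of_closedBall_subset {ι : Type*} [Fintype ι] (y : ι → V) {r : ℝ}
    (hr : 0 ≤ r) (h : Metric.closedBall (0 : V) 1 ⊆ ⋃ i, Metric.closedBall (y i) r) :
    1 ≤ Fintype.card ι * r ^ finrank ℝ V := by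
  borelize V
  let μ : Measure V := Measure.addHaar
  have h1 : μ (Metric.closedBall (0 : V) 1) ≤ ∑ i, μ (Metric.closedBall (y i) r) :=
    (measure_mono h).trans (measure_iUnion_fintype_le _ _)
  simp only [Measure.addHaar_closedBall μ _ hr, Measure.addHaar_closedBall μ _ zero_le_one,
    Finset.sum_const, Finset.card_univ, nsmul_eq_mul, one_pow, ENNReal.ofReal_one] at h1
  rw [← mul_assoc, ENNReal.mul_le_mul_iff_left (Metric.measure_ball_pos μ 0 one_pos).ne'
    measure_ball_lt_top.ne] at h1
  rw [← ENNReal.ofReal_natCast, ← ENNReal.ofReal_mul (by positivity), ENNReal.one_le_ofReal] at h1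
  exact h1

/-- The balls of radius `δ / 2` around separated points are disjoint. They lie in the ellipsoid
enlarged by `3 / 2`, because the ball of radius `δ / 2` at the origin is contained in half the
ellipsoid. -/
lemma card_mul_pow_le_of_separated (T : V →ₗ[ℝ] V) {δ : ℝ} (hδ : 0 < δ)
    (hT : Metric.closedBall (0 : V) δ ⊆ T '' Metric.closedBall 0 1) (F : Finset V)
    (hF : (F : Set V) ⊆ T '' Metric.closedBall 0 1)
    (hsep : (F : Set V).Pairwise fun x y => δ < dist x y) :
    F.card * (δ / 2) ^ finrank ℝ V ≤ |LinearMap.det T| * (3 / 2) ^ finrank ℝ V := by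
  borelize V
  let μ : Measure V := Measure.addHaar
  have h1 : μ (⋃ x ∈ F, Metric.ball x (δ / 2)) = ∑ x ∈ F, μ (Metric.ball x (δ / 2)) := by
    refine measure_biUnion_finset (fun x hx y hy hxy => ?_) fun x _ => measurableSet_ball
    refine Metric.ball_disjoint_ball ?_
    linarith [hsep hx hy hxy]
  have h2 : (⋃ x ∈ F, Metric.ball x (δ / 2)) ⊆ T '' Metric.closedBall 0 (3 / 2) := by
    intro z hz
    simp only [Set.mem_iUnion] at hz
    obtain ⟨x, hx, hz⟩ := hz
    obtain ⟨b, hb, rfl⟩ := hF hx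
    have h3 : (2 : ℝ) • (z - T b) ∈ Metric.closedBall (0 : V) δ := by
      rw [Metric.mem_ball, dist_eq_norm] at hz
      rw [mem_closedBall_zero_iff, norm_smul]
      norm_num
      linarith
    obtain ⟨b', hb', hz'⟩ := hT h3
    rw [mem_closedBall_zero_iff] at hb hb'
    refine ⟨b + (1 / 2 : ℝ) • b', ?_, ?_⟩
    · rw [mem_closedBall_zero_iff]
      refine (norm_add_le _ _).trans ?_
      rw [norm_smul]
      norm_num
      linarith
    · rw [map_add, map_smul, hz', smul_smul]
      norm_num
  have h3 := measure_mono (μ := μ) h2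
  rw [h1, Measure.addHaar_image_linearMap, Measure.addHaar_closedBall μ _ (by norm_num)] at h3
  simp only [Measure.addHaar_ball_of_pos μ _ (half_pos hδ), Finset.sum_const, nsmul_eq_mul] at h3
  rw [← mul_assoc, ← mul_assoc, ENNReal.mul_le_mul_iff_left
    (Metric.measure_ball_pos μ 0 one_pos).ne' measure_ball_lt_top.ne, ← ENNReal.ofReal_natCast,
    ← ENNReal.ofReal_mul (by positivity), ← ENNReal.ofReal_mul (by positivity),
    ENNReal.ofReal_le_ofReal_iff (by positivity)] at h3
  exact h3

/-- The image of the unit ball under `T` is covered by as many balls as the volumes suggest. -/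
lemma exists_cover_image_closedBall (T : V →ₗ[ℝ] V) {δ : ℝ} (hδ : 0 < δ)
    (hT : Metric.closedBall (0 : V) δ ⊆ T '' Metric.closedBall 0 1) {N : ℕ}
    (hN : 3 ^ finrank ℝ V * |LinearMap.det T| ≤ N * δ ^ finrank ℝ V) :
    ∃ y : Fin N → V, T '' Metric.closedBall 0 1 ⊆ ⋃ i, Metric.closedBall (y i) δ := by
  set E : Set V := T '' Metric.closedBall 0 1 with hE
  have hcard : ∀ F : Finset V, (F : Set V) ⊆ E →
      (F : Set V).Pairwise (fun x y => δ < dist x y) → F.card ≤ N := by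
    intro F hF hsep
    have h := card_mul_pow_le_of_separated T hδ hT F hF hsep
    have hp : (0 : ℝ) < δ ^ finrank ℝ V := by positivity
    have hq : (0 : ℝ) < 2 ^ finrank ℝ V := by positivity
    rw [div_pow, div_pow, mul_div_assoc', mul_div_assoc', div_le_div_iff_of_pos_right hq] at h
    have h2 : (F.card : ℝ) * δ ^ finrank ℝ V ≤ N * δ ^ finrank ℝ V := by linarith
    exact_mod_cast le_of_mul_le_mul_right h2 hp
  -- a separated set of the largest cardinality
  let P : ℕ → Prop := fun m => ∃ F : Finset V, (F : Set V) ⊆ E ∧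
    (F : Set V).Pairwise (fun x y => δ < dist x y) ∧ F.card = m
  classical
  have hP0 : P 0 := ⟨∅, by simp, by simp, by simp⟩
  -- A maximal separated set is automatically a `δ`-net; `hcard` ensures that restricting the search
  -- to cardinalities up to `N` loses nothing.
  obtain ⟨F, hFE, hFs, hFc⟩ : P (Nat.findGreatest P N) := Nat.findGreatest_spec (Nat.zero_le N) hP0
  have hcov : ∀ z ∈ E, ∃ x ∈ F, dist z x ≤ δ := by
    by_contra! hcon
    obtain ⟨z, hz, hzF⟩ := hcon
    have hzn : z ∉ F := fun h => by
      have := hzF z h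
      rw [dist_self] at this
      linarith
    have hP : P (F.card + 1) := by
      refine ⟨insert z F, ?_, ?_, Finset.card_insert_of_notMem hzn⟩
      · rw [Finset.coe_insert]
        exact Set.insert_subset hz hFE
      · rw [Finset.coe_insert, Set.pairwise_insert]
        exact ⟨hFs, fun x hx _ => ⟨hzF x hx, by rw [dist_comm]; exact hzF x hx⟩⟩
    have hle : F.card + 1 ≤ N := by
      obtain ⟨G, hG, hGs, hGc⟩ := hP
      exact hGc ▸ hcard G hG hGs
    have := Nat.le_findGreatest hle hP
    omega
  have hFN : F.card ≤ N := hcard F hFE hFs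
  -- Surplus centres are placed at `0`, as exactly `N` are required.
  refine ⟨fun i => if h : (i : ℕ) < F.card then F.equivFin.symm ⟨i, h⟩ else 0, fun z hz => ?_⟩
  obtain ⟨x, hx, hzx⟩ := hcov z hz
  have hi := (F.equivFin ⟨x, hx⟩).2
  refine Set.mem_iUnion.2 ⟨⟨F.equivFin ⟨x, hx⟩, hi.trans_le hFN⟩, ?_⟩
  rw [Metric.mem_closedBall]
  simpa using hzx

end Covering

/-! ### Lower bounds of the entropy numbers by volume comparison -/

section EntropyLower

variable {𝕜 : Type*} [RCLike 𝕜]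
variable {X : Type*} [NormedAddCommGroup X] [NormedSpace 𝕜 X]
variable {Y : Type*} [NormedAddCommGroup Y] [InnerProductSpace 𝕜 Y]

lemma finrank_real_euclideanSpace (ι : Type*) [Fintype ι] :
    Module.finrank ℝ (EuclideanSpace 𝕜 ι) = Fintype.card ι * Module.finrank ℝ 𝕜 := by
  rw [(WithLp.linearEquiv 2 ℝ (ι → 𝕜)).finrank_eq, Module.finrank_pi_fintype]
  simp

/-- A covering in `Y` is pulled back to the Euclidean space by `Φ`, the orthogonal projection onto
the range of `T ∘ J` followed by the inverse, of norm at most `1 / τ`. If `ε < τ / 2`, the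
pulled-back balls have total volume at most `2 ^ (n - 1) * (1 / 2) ^ n = 1 / 2` of the unit ball. -/
lemma half_le_entropyNumber {n : ℕ} {τ : ℝ} {T : X →L[𝕜] Y} (hn : 1 ≤ n) (hτ : 0 < τ)
    (h : IsBoundedBelowBy n τ T) : τ / 2 ≤ entropyNumber n T := by
  obtain ⟨J, hJ⟩ := h
  refine le_csInf ⟨‖T‖ + 1, by positivity, fun _ => 0, ?_⟩ ?_
  · rintro _ ⟨x, hx, rfl⟩
    refine Set.mem_iUnion.2 ⟨⟨0, by positivity⟩, ?_⟩
    rw [mem_closedBall_zero_iff] at hx ⊢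
    have := T.le_of_opNorm_le_of_le le_rfl hx
    linarith
  · rintro ε ⟨hε, y, hy⟩
    set S : EuclideanSpace 𝕜 (Fin n) →ₗ[𝕜] Y := T.toLinearMap.comp J.toLinearMap with hS
    have hSn : ∀ v, τ * ‖v‖ ≤ ‖S v‖ := hJ
    have hinj : Function.Injective S := by
      refine (injective_iff_map_eq_zero S).2 fun v hv => ?_
      have := hSn v
      rw [hv, norm_zero] at this
      exact norm_eq_zero.1 (le_antisymm (nonpos_of_mul_nonpos_right this hτ) (norm_nonneg _))
    let e := LinearEquiv.ofInjective S hinj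
    let Φ : Y →ₗ[𝕜] EuclideanSpace 𝕜 (Fin n) :=
      e.symm.toLinearMap.comp S.range.orthogonalProjectionOnto.toLinearMap
    have hΦS : ∀ v, Φ (S v) = v := by
      intro v
      have h1 : S.range.orthogonalProjectionOnto (S v) = e v :=
        Submodule.orthogonalProjectionOnto_mem_subspace_eq_self (e v)
      change e.symm (S.range.orthogonalProjectionOnto (S v)) = v
      rw [h1, LinearEquiv.symm_apply_apply]
    have hΦn : ∀ z, ‖Φ z‖ ≤ ‖z‖ / τ := by
      intro z
      rw [le_div_iff₀ hτ, mul_comm]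
      refine (hSn _).trans ?_
      have h1 : S (Φ z) = S.range.orthogonalProjectionOnto z :=
        congrArg Subtype.val (e.apply_symm_apply (S.range.orthogonalProjectionOnto z))
      rw [h1]
      exact S.range.norm_orthogonalProjectionOnto_apply_le z
    have hcov : Metric.closedBall (0 : EuclideanSpace 𝕜 (Fin n)) 1 ⊆
        ⋃ i, Metric.closedBall (Φ (y i)) (ε / τ) := by
      intro v hv
      rw [mem_closedBall_zero_iff] at hv
      obtain ⟨i, hi⟩ := Set.mem_iUnion.1 (hy ⟨J v, by simpa using hv, rfl⟩)
      refine Set.mem_iUnion.2 ⟨i, ?_⟩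
      rw [Metric.mem_closedBall, dist_eq_norm] at hi ⊢
      have h2 : v - Φ (y i) = Φ (S v - y i) := by rw [map_sub, hΦS]
      rw [h2]
      exact (hΦn _).trans (by gcongr; exact hi)
    have hvol := one_le_card_mul_pow_of_closedBall_subset _ (by positivity) hcov
    by_contra! hlt
    have h3 : ε / τ < 1 / 2 := by rw [div_lt_iff₀ hτ]; linarith
    -- Volumes see the real dimension, which is `n` or `2 * n`; as the radius is below `1`, the
    -- exponent `n` suffices.
    have hdim : n ≤ Module.finrank ℝ (EuclideanSpace 𝕜 (Fin n)) := by
      rw [finrank_real_euclideanSpace, Fintype.card_fin]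
      exact Nat.le_mul_of_pos_right _ Module.finrank_pos
    have h4 : (ε / τ) ^ Module.finrank ℝ (EuclideanSpace 𝕜 (Fin n)) ≤ (1 / 2) ^ n :=
      (pow_le_pow_of_le_one (by positivity) (by linarith) hdim).trans (by gcongr)
    rw [Fintype.card_fin] at hvol
    have h5 : (1 : ℝ) ≤ (2 ^ (n - 1) : ℕ) * (1 / 2) ^ n := hvol.trans (by gcongr)
    obtain ⟨m, rfl⟩ : ∃ m, n = m + 1 := ⟨n - 1, by omega⟩
    have h6 : ((2 ^ (m + 1 - 1) : ℕ) : ℝ) * (1 / 2) ^ (m + 1) = 1 / 2 := by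
      push_cast
      rw [pow_succ, ← mul_assoc, ← mul_pow]
      norm_num
    linarith

end EntropyLower

/-! ### The embedding as a diagonal operator -/

section HermiteEmbedding

variable {𝕜 : Type*} [RCLike 𝕜] {d : ℕ} {α : ℝ}

lemma hermiteWeight_eq_crossProd_rpow (α : ℝ) (k : Fin d → ℕ) :
    hermiteWeight α k = crossProd k ^ α :=
  Real.finsetProd_rpow _ _ (fun j _ => by positivity) _

namespace HermiteSpace

/-- Parseval's identity, obtained by pairing the Hermite series of `f` with `f` itself. -/
lemma hasSum_norm_sq (f : HermiteSpace 𝕜 d α) :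
    HasSum (fun k : Fin d → ℕ => ‖hermiteCoeff (toL2 f) k‖ ^ 2) (‖toL2 f‖ ^ 2) := by
  have h := RCLike.hasSum_re 𝕜 (f.hasSum.mapL (innerSL 𝕜 (toL2 f)))
  convert h using 1
  · funext k
    rw [innerSL_apply_apply, inner_smul_right, ← inner_conj_symm, ← hermiteCoeff_eq_inner,
      RCLike.mul_conj]
    norm_cast
  · rw [innerSL_apply_apply, inner_self_eq_norm_sq]

/-- The Hermite polynomial with multi-index `k` as an element of `ℋ^α`. -/
noncomputable def hermite (𝕜 : Type*) [RCLike 𝕜] {d : ℕ} (α : ℝ) (k : Fin d → ℕ) : HermiteSpace 𝕜 d α :=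
  ⟨hermiteL2 𝕜 k, by
    constructor
    · classical
      convert hasSum_ite_eq k (hermiteL2 𝕜 k) using 2 with l
      rw [hermiteCoeff_hermiteL2]
      by_cases h : k = l
      · simp [h]
      · simp [h, Ne.symm h]
    · refine summable_of_ne_finset_zero (s := {k}) fun l hl => ?_
      rw [hermiteCoeff_hermiteL2, if_neg (by simpa [eq_comm] using hl)]
      simp⟩

lemma toL2_hermite (k : Fin d → ℕ) : toL2 (hermite 𝕜 α k) = hermiteL2 𝕜 k := rfl

lemma norm_toL2_le_mul {δ : ℝ} (hδ : 0 ≤ δ) (f : HermiteSpace 𝕜 d α)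
    (h : ∀ k, hermiteCoeff (toL2 f) k ≠ 0 → 1 ≤ δ ^ 2 * hermiteWeight α k) :
    ‖toL2 f‖ ≤ δ * ‖f‖ := by
  refine le_of_sq_le_sq ?_ (by positivity)
  rw [mul_pow, norm_sq]
  refine hasSum_le (fun k => ?_) f.hasSum_norm_sq (f.summable.hasSum.mul_left _)
  by_cases hk : hermiteCoeff (toL2 f) k = 0
  · simp [hk]
  · rw [← mul_assoc]
    exact le_mul_of_one_le_left (by positivity) (h k hk)

lemma mul_norm_le_norm_toL2 {δ : ℝ} (f : HermiteSpace 𝕜 d α)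
    (h : ∀ k, hermiteCoeff (toL2 f) k ≠ 0 → δ ^ 2 * hermiteWeight α k ≤ 1) :
    δ * ‖f‖ ≤ ‖toL2 f‖ := by
  refine le_of_sq_le_sq ?_ (by positivity)
  rw [mul_pow, norm_sq]
  refine hasSum_le (fun k => ?_) (f.summable.hasSum.mul_left _) f.hasSum_norm_sq
  by_cases hk : hermiteCoeff (toL2 f) k = 0
  · simp [hk]
  · rw [← mul_assoc]
    exact mul_le_of_le_one_left (by positivity) (h k hk)

lemma hermiteCoeff_sum_smul_hermiteL2 {ι : Type*} (s : Finset ι) (c : ι → 𝕜)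
    (κ : ι → Fin d → ℕ) (l : Fin d → ℕ) :
    hermiteCoeff (∑ i ∈ s, c i • hermiteL2 𝕜 (κ i)) l =
      ∑ i ∈ s, if κ i = l then c i else 0 := by
  rw [hermiteCoeff_eq_inner, inner_sum]
  refine Finset.sum_congr rfl fun i _ => ?_
  rw [inner_smul_right, ← hermiteCoeff_eq_inner, hermiteCoeff_hermiteL2]
  simp

/-- The truncation error of the Hermite series outside of a finite set of multi-indices. -/
lemma norm_toL2_sub_sum_le {δ : ℝ} (hδ : 0 ≤ δ) (S : Finset (Fin d → ℕ))
    (hS : ∀ k, k ∉ S → 1 ≤ δ ^ 2 * hermiteWeight α k) (f : HermiteSpace 𝕜 d α) :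
    ‖toL2 f - ∑ k ∈ S, hermiteCoeff (toL2 f) k • hermiteL2 𝕜 k‖ ≤ δ * ‖f‖ := by
  classical
  -- The remainder is formed inside `ℋ^α`, where its norm is at most that of `f` and the
  -- coordinatewise comparison applies.
  set g : HermiteSpace 𝕜 d α := f - ∑ k ∈ S, hermiteCoeff (toL2 f) k • hermite 𝕜 α k with hg
  have hgL : toL2 g = toL2 f - ∑ k ∈ S, hermiteCoeff (toL2 f) k • hermiteL2 𝕜 k := by
    simp [hg, map_sub, map_sum, toL2_hermite]
  have hgc : ∀ l, hermiteCoeff (toL2 g) l = if l ∈ S then 0 else hermiteCoeff (toL2 f) l := by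
    intro l
    rw [hgL, hermiteCoeff_eq_inner, inner_sub_right, ← hermiteCoeff_eq_inner,
      ← hermiteCoeff_eq_inner, hermiteCoeff_sum_smul_hermiteL2]
    split_ifs with hl <;> simp [hl]
  have hgn : ‖g‖ ≤ ‖f‖ := by
    refine le_of_sq_le_sq ?_ (norm_nonneg _)
    rw [norm_sq, norm_sq]
    refine g.summable.tsum_le_tsum (fun l => ?_) f.summable
    have := (hermiteWeight_pos α l).le
    rw [hgc]
    split_ifs
    · simp; positivity
    · rfl
  rw [← hgL]
  refine (norm_toL2_le_mul hδ g fun k hk => hS k fun hkS => hk ?_).trans (by gcongr)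
  rw [hgc, if_pos hkS]

variable (𝕜 α) in
/-- The span of finitely many Hermite polynomials is a Euclidean subspace of `ℋ^α`. -/
lemma exists_linearIsometry {n : ℕ} (κ : Fin n ↪ (Fin d → ℕ)) :
    ∃ J : EuclideanSpace 𝕜 (Fin n) →ₗᵢ[𝕜] HermiteSpace 𝕜 d α,
      ∀ v k, hermiteCoeff (toL2 (J v)) k ≠ 0 → k ∈ Set.range κ := by
  classical
  -- In `ℋ^α` the Hermite polynomial has norm `√(hermiteWeight α (κ i))`, so these factors normalize
  -- it.
  let t : Fin n → 𝕜 := fun i => (((√(hermiteWeight α (κ i)))⁻¹ : ℝ) : 𝕜)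
  let f : EuclideanSpace 𝕜 (Fin n) →ₗ[𝕜] HermiteSpace 𝕜 d α :=
    ∑ i, (EuclideanSpace.proj i : EuclideanSpace 𝕜 (Fin n) →L[𝕜] 𝕜).toLinearMap.smulRight
      (t i • hermite 𝕜 α (κ i))
  have hf : ∀ v, toL2 (f v) = ∑ i, (v i * t i) • hermiteL2 𝕜 (κ i) := by
    intro v
    simp [f, map_sum, toL2_hermite, mul_smul]
  have hc : ∀ v k, hermiteCoeff (toL2 (f v)) k = ∑ i, if κ i = k then v i * t i else 0 := by
    intro v k
    rw [hf, hermiteCoeff_sum_smul_hermiteL2]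
  have hcκ : ∀ v i, hermiteCoeff (toL2 (f v)) (κ i) = v i * t i := by
    intro v i
    rw [hc]
    simp
  have hc0 : ∀ v k, hermiteCoeff (toL2 (f v)) k ≠ 0 → k ∈ Set.range κ := by
    intro v k hk
    by_contra hcon
    refine hk ?_
    rw [hc]
    exact Finset.sum_eq_zero fun i _ => if_neg fun h => hcon ⟨i, h⟩
  refine ⟨⟨f, fun v => ?_⟩, hc0⟩
  have h2 : ‖f v‖ ^ 2 = ‖v‖ ^ 2 := by
    rw [norm_sq, EuclideanSpace.norm_sq_eq, tsum_eq_sum (s := Finset.univ.map κ), Finset.sum_map]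
    · refine Finset.sum_congr rfl fun i _ => ?_
      have hw := hermiteWeight_pos α (κ i)
      rw [hcκ, norm_mul, RCLike.norm_ofReal, abs_of_nonneg (by positivity), mul_pow, inv_pow,
        Real.sq_sqrt hw.le]
      field_simp
    · intro k hk
      have : hermiteCoeff (toL2 (f v)) k = 0 := by
        by_contra h
        obtain ⟨i, rfl⟩ := hc0 v k h
        simp at hk
      simp [this]
  exact (sq_eq_sq₀ (norm_nonneg _) (norm_nonneg _)).1 h2

end HermiteSpace

lemma exists_nat_crossProd (k : Fin d → ℕ) : ∃ p : ℕ, crossProd k = p :=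
  ⟨∏ j, (k j + 1), by simp [crossProd]⟩

/-- The products are integers, so exceeding `m - 1` means being at least `m`. -/
lemma le_crossProd_of_notMem {e n : ℕ} {k : Fin (e + 1) → ℕ}
    (hk : k ∉ hyperbolicCross (e + 1) ((crossValue e n - 1 : ℕ) : ℝ)) :
    (crossValue e n : ℝ) ≤ crossProd k := by
  obtain ⟨p, hp⟩ := exists_nat_crossProd k
  rw [mem_hyperbolicCross, hp, Nat.cast_le] at hk
  rw [hp, Nat.cast_le]
  omega

lemma sq_rpow_neg_half_mul_hermiteWeight {x : ℝ} (hx : 0 < x) (k : Fin d → ℕ) :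
    (x ^ (-(α / 2))) ^ 2 * hermiteWeight α k = (crossProd k / x) ^ α := by
  rw [hermiteWeight_eq_crossProd_rpow, Real.div_rpow (crossProd_pos k).le hx.le,
    ← Real.rpow_natCast, ← Real.rpow_mul hx.le]
  have : -(α / 2) * (2 : ℕ) = -α := by push_cast; ring
  rw [this, Real.rpow_neg hx.le]
  field_simp

lemma isCompressibleTo_hermiteEmbedding (e : ℕ) (hα : 0 < α) {n : ℕ} (hn : 1 ≤ n) :
    IsCompressibleTo n ((crossValue e n : ℝ) ^ (-(α / 2)))
      (hermiteEmbedding 𝕜 (e + 1) α hα.le) := by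
  have hm : 1 ≤ crossValue e n := crossValue_pos hn
  have hm0 : (0 : ℝ) < crossValue e n := by exact_mod_cast hm
  have hcard := card_hyperbolicCross_lt (e := e) (n := n) (m := crossValue e n - 1) (by omega)
  -- The cross at `m - 1` has at most `n - 1` points; it is padded because the compression must have
  -- dimension exactly `n - 1`.
  obtain ⟨S, hS, hSc⟩ := Infinite.exists_superset_card_eq
    (hyperbolicCross (e + 1) ((crossValue e n - 1 : ℕ) : ℝ)) (n - 1) (by omega)
  let v : S → GaussianL2 𝕜 (e + 1) := fun k => hermiteL2 𝕜 (k : Fin (e + 1) → ℕ)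
  have hv : Orthonormal 𝕜 v := (orthonormal_hermiteL2 𝕜 (e + 1)).comp _ Subtype.val_injective
  let W := Submodule.span 𝕜 (Set.range v)
  have hW : FiniteDimensional 𝕜 W := FiniteDimensional.span_of_finite 𝕜 (Set.finite_range v)
  refine ⟨W, hW, ?_, fun f => ?_⟩
  · rw [finrank_span_eq_card hv.linearIndependent, Fintype.card_coe, hSc]
  · have h1 := HermiteSpace.norm_toL2_sub_sum_le (δ := (crossValue e n : ℝ) ^ (-(α / 2)))
      (by positivity) S (fun k hk => by
        rw [sq_rpow_neg_half_mul_hermiteWeight hm0]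
        refine Real.one_le_rpow ?_ hα.le
        rw [one_le_div hm0]
        exact le_crossProd_of_notMem fun h => hk (hS h)) f
    refine le_trans ?_ h1
    change ‖HermiteSpace.toL2 f - W.starProjection (HermiteSpace.toL2 f)‖ ≤ _
    -- The orthogonal projection is the best approximation from `W`, hence at least as good as the
    -- truncated Hermite series.
    rw [Submodule.starProjection_minimal]
    refine ciInf_le (bddBelow_range_norm_sub W _) (⟨_, ?_⟩ : W)
    exact Submodule.sum_mem _ fun k hk => Submodule.smul_mem _ _
      (Submodule.subset_span ⟨⟨k, hk⟩, rfl⟩)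

lemma isBoundedBelowBy_hermiteEmbedding (e : ℕ) (hα : 0 < α) {n : ℕ} (hn : 1 ≤ n) :
    IsBoundedBelowBy n ((crossValue e n : ℝ) ^ (-(α / 2)))
      (hermiteEmbedding 𝕜 (e + 1) α hα.le) := by
  have hm0 : (0 : ℝ) < crossValue e n := by exact_mod_cast (crossValue_pos hn : 1 ≤ crossValue e n)
  obtain ⟨S, hS, hSc⟩ := Finset.exists_subset_card_eq (le_card_hyperbolicCross_crossValue e n)
  let κ : Fin n ↪ (Fin (e + 1) → ℕ) :=
    (S.equivFinOfCardEq hSc).symm.toEmbedding.trans (Function.Embedding.subtype _)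
  obtain ⟨J, hJ⟩ := HermiteSpace.exists_linearIsometry 𝕜 α κ
  refine ⟨J, fun v => ?_⟩
  rw [← J.norm_map v]
  refine HermiteSpace.mul_norm_le_norm_toL2 (J v) fun k hk => ?_
  obtain ⟨i, rfl⟩ := hJ v k hk
  rw [sq_rpow_neg_half_mul_hermiteWeight hm0]
  refine Real.rpow_le_one (div_nonneg (crossProd_pos _).le hm0.le) ?_ hα.le
  rw [div_le_one hm0]
  exact mem_hyperbolicCross.1 (hS ((S.equivFinOfCardEq hSc).symm i).2)

lemma sNumber_hermiteEmbedding {s : SKind} (hs : s ≠ SKind.e) (e : ℕ) (hα : 0 < α) {n : ℕ}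
    (hn : 1 ≤ n) : sNumber s n (hermiteEmbedding 𝕜 (e + 1) α hα.le) =
      (crossValue e n : ℝ) ^ (-(α / 2)) :=
  sNumber_eq hs hn (by positivity) (isCompressibleTo_hermiteEmbedding e hα hn)
    (isBoundedBelowBy_hermiteEmbedding e hα hn)

end HermiteEmbedding

/-! ### Upper bounds of the entropy numbers -/

section EntropyUpper

variable {𝕜 : Type*} [RCLike 𝕜] {d : ℕ} {α : ℝ}

variable (𝕜) in
/-- The real-linear map that multiplies the coordinates by real numbers. -/
noncomputable def coordScaling {ι : Type*} (t : ι → ℝ) :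
    EuclideanSpace 𝕜 ι →ₗ[ℝ] EuclideanSpace 𝕜 ι :=
  let e := (WithLp.linearEquiv 2 ℝ (ι → 𝕜)).symm
  e.toLinearMap ∘ₗ (LinearMap.pi fun i => (t i • LinearMap.id) ∘ₗ LinearMap.proj i) ∘ₗ
    e.symm.toLinearMap

lemma coordScaling_apply {ι : Type*} (t : ι → ℝ) (x : EuclideanSpace 𝕜 ι) (i : ι) :
    coordScaling 𝕜 t x i = t i • x i := by
  simp [coordScaling]

/-- The determinant is that of a real-linear map, so each coordinate counts with the real dimension
of `𝕜`. -/
lemma det_coordScaling {ι : Type*} [Fintype ι] (t : ι → ℝ) :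
    LinearMap.det (coordScaling 𝕜 t) = ∏ i, t i ^ Module.finrank ℝ 𝕜 := by
  rw [coordScaling, LinearMap.det_conj, LinearMap.det_pi]
  simp

lemma closedBall_subset_coordScaling_image {ι : Type*} [Fintype ι] {t : ι → ℝ} {δ : ℝ}
    (hδ : 0 < δ) (ht : ∀ i, δ ≤ t i) :
    Metric.closedBall (0 : EuclideanSpace 𝕜 ι) δ ⊆
      coordScaling 𝕜 t '' Metric.closedBall 0 1 := by
  intro w hw
  rw [mem_closedBall_zero_iff] at hw
  refine ⟨coordScaling 𝕜 (fun i => (t i)⁻¹) w, ?_, ?_⟩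
  · rw [mem_closedBall_zero_iff, ← sq_le_one_iff₀ (norm_nonneg _), EuclideanSpace.norm_sq_eq]
    have h1 : ‖w‖ ^ 2 ≤ δ ^ 2 := by gcongr
    rw [EuclideanSpace.norm_sq_eq] at h1
    have h2 : ∀ i ∈ Finset.univ, ‖coordScaling 𝕜 (fun i => (t i)⁻¹) w i‖ ^ 2 ≤
        (δ ^ 2)⁻¹ * ‖w i‖ ^ 2 := by
      intro i _
      have := hδ.trans_le (ht i)
      rw [coordScaling_apply, norm_smul, Real.norm_of_nonneg (by positivity), mul_pow, inv_pow]
      gcongr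
      exact ht i
    refine (Finset.sum_le_sum h2).trans ?_
    rw [← Finset.mul_sum, inv_mul_le_iff₀ (by positivity), mul_one]
    exact h1
  · ext i
    rw [coordScaling_apply, coordScaling_apply, smul_smul,
      mul_inv_cancel₀ (hδ.trans_le (ht i)).ne', one_smul]

/-- The left side is the number of balls demanded by the volume count, with semi-axes measured in
units of `x ^ (-(α / 2))`. In its logarithm, both the number of points and the sum of `log (x /
crossProd k)` are at most `x * crossSum e x`. -/
lemma prod_crossProd_le (e : ℕ) (hα : 0 < α) {x : ℝ} (hx : 0 < x) (r : ℕ) :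
    (3 : ℝ) ^ ((hyperbolicCross (e + 1) x).card * r) *
      ∏ k ∈ hyperbolicCross (e + 1) x, ((x / crossProd k) ^ (α / 2)) ^ r ≤
      Real.exp (r * (2 + α) * (x * crossSum e x)) := by
  set H := hyperbolicCross (e + 1) x
  have h1 : ∏ k ∈ H, ((x / crossProd k) ^ (α / 2)) ^ r =
      Real.exp (r * (α / 2 * ∑ k ∈ H, Real.log (x / crossProd k))) := by
    rw [Finset.mul_sum, Finset.mul_sum, Real.exp_sum]
    refine Finset.prod_congr rfl fun k _ => ?_
    rw [Real.exp_nat_mul, mul_comm (α / 2),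
      ← Real.rpow_def_of_pos (div_pos hx (crossProd_pos k))]
  have h2 : (3 : ℝ) ^ (H.card * r) ≤ Real.exp (r * (2 * H.card)) := by
    have h3 : (3 : ℝ) ≤ Real.exp 2 := by
      have := Real.add_one_le_exp (2 : ℝ)
      linarith
    calc (3 : ℝ) ^ (H.card * r) ≤ Real.exp 2 ^ (H.card * r) := by gcongr
      _ = Real.exp (r * (2 * H.card)) := by
        rw [← Real.exp_nat_mul]
        push_cast
        ring_nf
  rw [h1]
  refine (mul_le_mul_of_nonneg_right h2 (Real.exp_pos _).le).trans ?_
  rw [← Real.exp_add, Real.exp_le_exp, ← mul_add, mul_assoc]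
  refine mul_le_mul_of_nonneg_left ?_ (Nat.cast_nonneg _)
  have h4 := card_hyperbolicCross_succ_le (d := e) hx.le
  have h5 := sum_log_div_crossProd_le e hx
  have h6 : 0 ≤ x * crossSum e x := mul_nonneg hx.le (crossSum_nonneg e x)
  calc 2 * (H.card : ℝ) + α / 2 * ∑ k ∈ H, Real.log (x / crossProd k)
      ≤ 2 * (x * crossSum e x) + α / 2 * (x * crossSum e x) := by gcongr
    _ ≤ (2 + α) * (x * crossSum e x) := by nlinarith

variable (𝕜) in
lemma abs_det_coordScaling_mul {S : Finset (Fin d → ℕ)} {δ : ℝ} (hδ : 0 ≤ δ)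
    {g : (Fin d → ℕ) → ℝ} (hg : ∀ k, 0 ≤ g k) :
    |LinearMap.det (coordScaling 𝕜 fun k : S => δ * g k)| =
      δ ^ (S.card * Module.finrank ℝ 𝕜) * ∏ k ∈ S, g k ^ Module.finrank ℝ 𝕜 := by
  rw [det_coordScaling, abs_of_nonneg (Finset.prod_nonneg fun k _ =>
    pow_nonneg (mul_nonneg hδ (hg _)) _)]
  rw [Finset.prod_coe_sort S fun k => (δ * g k) ^ Module.finrank ℝ 𝕜]
  simp only [mul_pow, Finset.prod_mul_distrib, Finset.prod_const]
  rw [← pow_mul, mul_comm (Module.finrank ℝ 𝕜)]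

variable (𝕜) in
lemma exists_cover_coordScaling (S : Finset (Fin d → ℕ)) {δ : ℝ} (hδ : 0 < δ)
    {g : (Fin d → ℕ) → ℝ} (hg : ∀ k, 0 ≤ g k) (hS : ∀ k ∈ S, 1 ≤ g k) {N : ℕ}
    (hN : 3 ^ (S.card * Module.finrank ℝ 𝕜) * ∏ k ∈ S, g k ^ Module.finrank ℝ 𝕜 ≤ (N : ℝ)) :
    ∃ y : Fin N → EuclideanSpace 𝕜 S,
      coordScaling 𝕜 (fun k : S => δ * g k) '' Metric.closedBall 0 1 ⊆
        ⋃ i, Metric.closedBall (y i) δ := by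
  have h1 := closedBall_subset_coordScaling_image (𝕜 := 𝕜) (t := fun k : S => δ * g k) hδ
    fun k => le_mul_of_one_le_right hδ.le (hS k k.2)
  refine exists_cover_image_closedBall _ hδ h1 ?_
  rw [finrank_real_euclideanSpace, Fintype.card_coe, abs_det_coordScaling_mul 𝕜 hδ.le hg]
  calc (3 : ℝ) ^ (S.card * Module.finrank ℝ 𝕜) *
        (δ ^ (S.card * Module.finrank ℝ 𝕜) * ∏ k ∈ S, g k ^ Module.finrank ℝ 𝕜)
      = (3 ^ (S.card * Module.finrank ℝ 𝕜) * ∏ k ∈ S, g k ^ Module.finrank ℝ 𝕜) *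
        δ ^ (S.card * Module.finrank ℝ 𝕜) := by ring
    _ ≤ N * δ ^ (S.card * Module.finrank ℝ 𝕜) := by gcongr

/-- By definition of the norm, finitely many coefficients of the unit ball of `ℋ^α` fill only an
ellipsoid with semi-axes `hermiteWeight α k ^ (-1 / 2)`. -/
lemma coeff_mem_coordScaling_image (S : Finset (Fin d → ℕ)) {f : HermiteSpace 𝕜 d α}
    (hf : ‖f‖ ≤ 1) :
    (WithLp.toLp 2 fun k : S => hermiteCoeff (HermiteSpace.toL2 f) k : EuclideanSpace 𝕜 S) ∈
      coordScaling 𝕜 (fun k : S => (√(hermiteWeight α (k : Fin d → ℕ)))⁻¹) ''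
        Metric.closedBall 0 1 := by
  have hw : ∀ k : Fin d → ℕ, 0 < √(hermiteWeight α k) := fun k =>
    Real.sqrt_pos.2 (hermiteWeight_pos α k)
  refine ⟨coordScaling 𝕜 (fun k : S => √(hermiteWeight α (k : Fin d → ℕ)))
    (WithLp.toLp 2 fun k : S => hermiteCoeff (HermiteSpace.toL2 f) (k : Fin d → ℕ)), ?_, ?_⟩
  · rw [mem_closedBall_zero_iff, ← sq_le_one_iff₀ (norm_nonneg _), EuclideanSpace.norm_sq_eq]
    have h : ∀ k : S, ‖coordScaling 𝕜 (fun k : S => √(hermiteWeight α (k : Fin d → ℕ)))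
        (WithLp.toLp 2 fun k : S => hermiteCoeff (HermiteSpace.toL2 f) (k : Fin d → ℕ)) k‖ ^ 2 =
        hermiteWeight α (k : Fin d → ℕ) *
          ‖hermiteCoeff (HermiteSpace.toL2 f) (k : Fin d → ℕ)‖ ^ 2 := fun k => by
      rw [coordScaling_apply, norm_smul, mul_pow, Real.norm_of_nonneg (hw _).le,
        Real.sq_sqrt (hermiteWeight_pos α _).le]
    rw [Finset.sum_congr rfl fun k _ => h k, Finset.sum_coe_sort S fun k =>
      hermiteWeight α k * ‖hermiteCoeff (HermiteSpace.toL2 f) k‖ ^ 2]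
    refine (f.summable.sum_le_tsum S fun k _ =>
      mul_nonneg (hermiteWeight_pos α k).le (by positivity)).trans ?_
    rw [← HermiteSpace.norm_sq]
    exact pow_le_one₀ (norm_nonneg _) hf
  · ext k
    rw [coordScaling_apply, coordScaling_apply, smul_smul, inv_mul_cancel₀ (hw _).ne', one_smul]

lemma inv_sqrt_hermiteWeight {x : ℝ} (hx : 0 < x) (k : Fin d → ℕ) :
    (√(hermiteWeight α k))⁻¹ = x ^ (-(α / 2)) * (x / crossProd k) ^ (α / 2) := by
  have hk := crossProd_pos k
  have h : α * (1 / 2) = α / 2 := by ring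
  rw [hermiteWeight_eq_crossProd_rpow, Real.sqrt_eq_rpow, ← Real.rpow_mul hk.le,
    Real.div_rpow hx.le hk.le, Real.rpow_neg hx.le, h]
  field_simp

/-- The tail outside the cross and the covering of the truncated part each contribute an error `x ^
(-(α / 2))`, whence the factor `2`. The hypothesis `h` says that `2 ^ (n - 1)` balls are enough for
the volume count. -/
lemma entropyNumber_hermiteEmbedding_le_of (e : ℕ) (hα : 0 < α) {n : ℕ} (hn : 1 ≤ n) {x : ℝ}
    (hx : 0 < x)
    (h : Module.finrank ℝ 𝕜 * (2 + α) * (x * crossSum e x) ≤ ((n : ℝ) - 1) * Real.log 2) :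
    entropyNumber n (hermiteEmbedding 𝕜 (e + 1) α hα.le) ≤ 2 * x ^ (-(α / 2)) := by
  have hN : Real.exp (Module.finrank ℝ 𝕜 * (2 + α) * (x * crossSum e x)) ≤
      ((2 ^ (n - 1) : ℕ) : ℝ) := by
    refine (Real.exp_le_exp.2 h).trans (le_of_eq ?_)
    rw [← Nat.cast_pred hn, Real.exp_nat_mul, Real.exp_log two_pos, Nat.cast_pow, Nat.cast_ofNat]
  rw [entropyNumber]
  generalize 2 ^ (n - 1) = N at hN ⊢
  have hpos : ∀ k : Fin (e + 1) → ℕ, 0 ≤ (x / crossProd k) ^ (α / 2) := fun k =>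
    Real.rpow_nonneg (div_nonneg hx.le (crossProd_pos k).le) _
  have hone : ∀ k ∈ hyperbolicCross (e + 1) x, 1 ≤ (x / crossProd k) ^ (α / 2) := fun k hk => by
    refine Real.one_le_rpow ?_ (by positivity)
    rw [one_le_div (crossProd_pos _)]
    exact mem_hyperbolicCross.1 hk
  obtain ⟨y, hy⟩ := exists_cover_coordScaling 𝕜 (hyperbolicCross (e + 1) x)
    (by positivity : 0 < x ^ (-(α / 2))) hpos hone ((prod_crossProd_le e hα hx _).trans hN)
  simp only [← inv_sqrt_hermiteWeight hx] at hy
  obtain ⟨J, hJ⟩ := exists_linearIsometry_of_orthonormal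
    ((orthonormal_hermiteL2 𝕜 (e + 1)).comp
      (Subtype.val : hyperbolicCross (e + 1) x → Fin (e + 1) → ℕ) Subtype.val_injective)
  refine csInf_le ⟨0, fun ε hε => hε.1.le⟩ ⟨by positivity, fun i => J (y i), ?_⟩
  rintro _ ⟨f, hf, rfl⟩
  rw [mem_closedBall_zero_iff] at hf
  obtain ⟨i, hi⟩ := Set.mem_iUnion.1 (hy (coeff_mem_coordScaling_image _ hf))
  refine Set.mem_iUnion.2 ⟨i, ?_⟩
  rw [Metric.mem_closedBall, ← J.dist_map, hJ] at hi
  have hsum := Finset.sum_coe_sort (hyperbolicCross (e + 1) x)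
    fun k => hermiteCoeff (HermiteSpace.toL2 f) k • hermiteL2 𝕜 k
  simp only [Function.comp] at hi
  rw [hsum] at hi
  rw [Metric.mem_closedBall]
  have h1 := HermiteSpace.norm_toL2_sub_sum_le (δ := x ^ (-(α / 2))) (by positivity)
    (hyperbolicCross (e + 1) x) (fun k hk => by
      rw [sq_rpow_neg_half_mul_hermiteWeight hx]
      refine Real.one_le_rpow ?_ hα.le
      rw [one_le_div hx]
      rw [mem_hyperbolicCross, not_le] at hk
      exact hk.le) f
  have h2 : x ^ (-(α / 2)) * ‖f‖ ≤ x ^ (-(α / 2)) := mul_le_of_le_one_right (by positivity) hf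
  rw [← dist_eq_norm] at h1
  have h3 := dist_triangle (HermiteSpace.toL2 f) _ (J (y i)) |>.trans (add_le_add h1 hi)
  refine h3.trans ?_
  linarith

lemma half_le_log_two : 1 / 2 ≤ Real.log 2 := by
  have := Real.log_two_gt_d9
  linarith

lemma exists_entropyNumber_hermiteEmbedding_le (𝕜 : Type*) [RCLike 𝕜] (e : ℕ) (hα : 0 < α) :
    ∃ C : ℝ, 0 < C ∧ ∀ n : ℕ, 2 ≤ n →
      entropyNumber n (hermiteEmbedding 𝕜 (e + 1) α hα.le) ≤
        C * ((n : ℝ) ^ (-(α / 2)) * Real.log n ^ ((e : ℝ) * α / 2)) := by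
  have hr : (0 : ℝ) < Module.finrank ℝ 𝕜 := by exact_mod_cast Module.finrank_pos
  set K : ℝ := Module.finrank ℝ 𝕜 * (2 + α) * (1 + 2 * e) ^ e with hK
  have hK0 : 0 < K := by positivity
  have hl2 := half_le_log_two
  -- The first entry gives `x ≤ n`, so `log x ≤ log n`. The second makes the exponent at most `n /
  -- 4`, which is below `(n - 1) * log 2` because `n ≥ 2` and `log 2 ≥ 1 / 2`.
  set c : ℝ := min (Real.log 2 ^ e) (1 / (4 * K)) with hc
  have hc0 : 0 < c := lt_min (by positivity) (by positivity)
  refine ⟨2 * c ^ (-(α / 2)), by positivity, fun n hn => ?_⟩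
  have hn2 : (2 : ℝ) ≤ n := by exact_mod_cast hn
  have hln : Real.log 2 ≤ Real.log n := Real.log_le_log two_pos hn2
  have hl0 : 0 < Real.log n := by linarith
  set x : ℝ := c * (n / Real.log n ^ e) with hx
  have hx0 : 0 < x := by positivity
  have hxn : x ≤ n := by
    have h1 : c ≤ Real.log n ^ e := (min_le_left _ _).trans (by gcongr)
    rw [hx, mul_div_assoc', div_le_iff₀ (by positivity), mul_comm (n : ℝ)]
    gcongr
  have hsum : crossSum e x ≤ (1 + 2 * e) ^ e * Real.log n ^ e := by
    rcases lt_or_ge x 1 with hx1 | hx1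
    · rw [crossSum, hyperbolicCross_eq_empty hx1, Finset.sum_empty]
      positivity
    · refine (crossSum_le e hx1).trans ?_
      have h2 : 0 ≤ Real.log x := Real.log_nonneg hx1
      have h3 : Real.log x ≤ Real.log n := Real.log_le_log hx0 hxn
      have h4 : (1 : ℝ) ≤ e.factorial := by exact_mod_cast e.factorial_pos
      refine (div_le_self (by positivity) h4).trans ?_
      rw [← mul_pow]
      gcongr
      -- Here `e ≤ 2 * e * log n`, as `log n ≥ 1 / 2`.
      nlinarith [(Nat.cast_nonneg e : (0 : ℝ) ≤ e)]
  have hcond : Module.finrank ℝ 𝕜 * (2 + α) * (x * crossSum e x) ≤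
      ((n : ℝ) - 1) * Real.log 2 := by
    calc Module.finrank ℝ 𝕜 * (2 + α) * (x * crossSum e x)
        ≤ Module.finrank ℝ 𝕜 * (2 + α) * (x * ((1 + 2 * e) ^ e * Real.log n ^ e)) := by gcongr
      _ = K * c * n := by
        rw [hx, hK]
        field_simp
      _ ≤ K * (1 / (4 * K)) * n := by
        gcongr
        exact min_le_right _ _
      _ = n / 4 := by field_simp
      _ ≤ ((n : ℝ) - 1) * Real.log 2 := by nlinarith
  refine (entropyNumber_hermiteEmbedding_le_of e hα (by omega) hx0 hcond).trans (le_of_eq ?_)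
  have h5 : (e : ℝ) * α / 2 = e * (α / 2) := by ring
  rw [hx, Real.mul_rpow hc0.le (by positivity), Real.div_rpow (by positivity) (by positivity),
    h5, Real.rpow_mul hl0.le, Real.rpow_natCast,
    Real.rpow_neg (by positivity : 0 ≤ Real.log n ^ e), div_inv_eq_mul]
  ring

end EntropyUpper

/-! ### The theorem -/

/-- The quotients and their inverses both converge, hence are bounded; positivity from `n = 2` on
makes these bounds usable for every such `n`, not only eventually. -/
lemma exists_bounds_of_tendsto {u w : ℕ → ℝ} {L : ℝ} (hL : 0 < L)
    (hu : Tendsto (fun n => u n / w n) atTop (𝓝 L)) (hpos : ∀ n, 2 ≤ n → 0 < u n)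
    (hw : ∀ n, 2 ≤ n → 0 < w n) :
    ∃ c C : ℝ, 0 < c ∧ 0 < C ∧ ∀ n, 2 ≤ n → c * w n ≤ u n ∧ u n ≤ C * w n := by
  obtain ⟨C, hC⟩ := hu.bddAbove_range
  obtain ⟨B, hB⟩ := (hu.inv₀ hL.ne').bddAbove_range
  have hC' : ∀ n, u n / w n ≤ C := fun n => hC ⟨n, rfl⟩
  have hB' : ∀ n, (u n / w n)⁻¹ ≤ B := fun n => hB ⟨n, rfl⟩
  have hq : ∀ n, 2 ≤ n → 0 < u n / w n := fun n hn => div_pos (hpos n hn) (hw n hn)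
  have hB0 : 0 < B := (inv_pos.2 (hq 2 le_rfl)).trans_le (hB' 2)
  refine ⟨B⁻¹, C, inv_pos.2 hB0, (hq 2 le_rfl).trans_le (hC' 2), fun n hn => ⟨?_, ?_⟩⟩
  · rw [← le_div_iff₀ (hw n hn)]
    exact inv_le_of_inv_le₀ (hq n hn) (hB' n)
  · rw [← div_le_iff₀ (hw n hn)]
    exact hC' n

theorem theorem4p2 (𝕜 : Type*) [RCLike 𝕜] (d : ℕ) (hd : 1 ≤ d) (α : ℝ) (hα : 0 < α) :
    (∀ s : SKind, ∃ c C : ℝ, 0 < c ∧ 0 < C ∧ ∀ n : ℕ, 2 ≤ n →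
      c * ((n : ℝ) ^ (-(α / 2)) * Real.log n ^ (((d : ℝ) - 1) * α / 2)) ≤
          sNumber s n (hermiteEmbedding 𝕜 d α hα.le) ∧
        sNumber s n (hermiteEmbedding 𝕜 d α hα.le) ≤
          C * ((n : ℝ) ^ (-(α / 2)) * Real.log n ^ (((d : ℝ) - 1) * α / 2))) ∧
    (∀ s : SKind, s ≠ SKind.e →
      Tendsto (fun n : ℕ => sNumber s n (hermiteEmbedding 𝕜 d α hα.le) /
          ((n : ℝ) ^ (-(α / 2)) * Real.log n ^ (α * ((d : ℝ) - 1) / 2)))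
        atTop (𝓝 ((1 / ((d - 1).factorial : ℝ)) ^ (α / 2)))) := by
  obtain ⟨e, rfl⟩ : ∃ e, d = e + 1 := ⟨d - 1, by omega⟩
  have hlim := tendsto_crossValue_rpow e α hα
  have he : (((e + 1 : ℕ) : ℝ) - 1) = e := by push_cast; ring
  have he' : (e : ℝ) * α / 2 = α * e / 2 := by ring
  rw [he, Nat.add_sub_cancel]
  obtain ⟨c, C, hc, hC, hcC⟩ := exists_bounds_of_tendsto (by positivity) hlim
    (fun n hn => by
      have : (0 : ℝ) < crossValue e n := by
        exact_mod_cast (crossValue_pos (by omega) : 1 ≤ crossValue e n)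
      positivity)
    (fun n hn => by
      have h1 : (1 : ℝ) < n := by exact_mod_cast hn
      have := Real.log_pos h1
      positivity)
  refine ⟨fun s => ?_, fun s hs => ?_⟩
  · by_cases hs : s = SKind.e
    · subst hs
      obtain ⟨C', hC', hle⟩ := exists_entropyNumber_hermiteEmbedding_le 𝕜 e hα
      -- The entropy number is at least half the `n`-th singular value, whose lower constant is `c`.
      refine ⟨c / 2, C', by positivity, hC', fun n hn => ⟨?_, hle n hn⟩⟩
      have hm : (0 : ℝ) < crossValue e n := by
        exact_mod_cast (crossValue_pos (by omega) : 1 ≤ crossValue e n)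
      refine le_trans ?_ (half_le_entropyNumber (by omega) (by positivity)
        (isBoundedBelowBy_hermiteEmbedding (𝕜 := 𝕜) e hα (by omega)))
      have := (hcC n hn).1
      rw [he']
      linarith
    · refine ⟨c, C, hc, hC, fun n hn => ?_⟩
      rw [sNumber_hermiteEmbedding hs e hα (by omega), he']
      exact hcC n hn
  · refine hlim.congr' ?_
    filter_upwards [eventually_ge_atTop 1] with n hn
    rw [sNumber_hermiteEmbedding hs e hα hn]
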